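/- There are a separable complex Hilbert space $H$ and a $C^*$-algebra $C\subseteq\mathcal B(H)$ (a norm-closed self-adjoint subalgebra) such that for every $\epsilon>0$ there is a nonseparable amenable operator algebra $\mathcal A_\epsilon\subseteq\mathcal B(H)$ (a norm-closed subalgebra, not assumed self-adjoint, nonseparable in the norm topology and amenable as a Banach algebra: every bounded derivation from $\mathcal A_\epsilon$ into the dual of a Banach $\mathcal A_\epsilon$-bimodule is inner) such that no nonseparable subalgebra of $\mathcal A_\epsilon$, unital or not (in particular not $\mathcal A_\epsilon$ itself), is isomorphic as a Banach algebra (by a bicontinuous algebra isomorphism) to a $C^*$-algebra, and $d_K(\mathcal A_\epsilon,C)<\epsilon$. Here \[d_K(A,B)=\max\Bigl\{\sup_{x\in A_1}\inf_{y\in B_1}\|x-y\|,\ \sup_{x\in B_1}\inf_{y\in A_1}\|x-y\|\Bigr\}\] is the Kadison–Kastler distance of two subalgebras $A,B\subseteq\mathcal B(H)$, where $A_1$ and $B_1$ are the sets of elements of norm $1$ in $A$ and $B$. -/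

import Mathlib

/-- A subalgebra of a normed algebra is a normed space with the restricted operations and norm. -/
instance NonUnitalSubalgebra.instNormedSpaceComplex {E : Type*} [NonUnitalNormedRing E]
    [NormedSpace ℂ E] (S : NonUnitalSubalgebra ℂ E) : NormedSpace ℂ S where
  toModule := NonUnitalSubalgebra.instModule (S := S)
  norm_smul_le c x := norm_smul_le c (x : E)

/-- The structure of a Banach `A`-bimodule on a complex normed space `X` (which is complete wherever
this is used): jointly bounded bilinear left and right actions `lact a x = a · x` and
`ract a x = x · a`, both associative, and commuting with each other. -/
structure BanachBimodule (A X : Type*) [NonUnitalNormedRing A] [NormedSpace ℂ A]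
    [IsScalarTower ℂ A A] [SMulCommClass ℂ A A] [NormedAddCommGroup X]
    [NormedSpace ℂ X] where
  /-- the left action `a · x` -/
  lact : A →L[ℂ] X →L[ℂ] X
  /-- the right action `x · a`, with the algebra element as first argument -/
  ract : A →L[ℂ] X →L[ℂ] X
  lact_mul : ∀ (a b : A) (x : X), lact (a * b) x = lact a (lact b x)
  ract_mul : ∀ (a b : A) (x : X), ract (a * b) x = ract b (ract a x)
  lact_ract : ∀ (a b : A) (x : X), lact a (ract b x) = ract b (lact a x)

namespace BanachBimodule

variable {A X : Type*} [NonUnitalNormedRing A] [NormedSpace ℂ A]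
  [IsScalarTower ℂ A A] [SMulCommClass ℂ A A] [NormedAddCommGroup X] [NormedSpace ℂ X]

/-- The left action of `A` on the dual of a bimodule: `(a · f)(x) = f (x · a)`. -/
noncomputable def dualLact (M : BanachBimodule A X) (a : A) (f : X →L[ℂ] ℂ) : X →L[ℂ] ℂ :=
  f.comp (M.ract a)

/-- The right action of `A` on the dual of a bimodule: `(f · a)(x) = f (a · x)`. -/
noncomputable def dualRact (M : BanachBimodule A X) (a : A) (f : X →L[ℂ] ℂ) : X →L[ℂ] ℂ :=
  f.comp (M.lact a)

/-- A bounded linear map `δ : A → X*` is a derivation if `δ (a b) = a · δ b + δ a · b`. -/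
def IsDualDerivation (M : BanachBimodule A X) (δ : A →L[ℂ] X →L[ℂ] ℂ) : Prop :=
  ∀ a b : A, δ (a * b) = M.dualLact a (δ b) + M.dualRact b (δ a)

/-- `δ : A → X*` is inner if `δ a = a · f - f · a` for some fixed `f` in `X*`. -/
def IsDualInner (M : BanachBimodule A X) (δ : A →L[ℂ] X →L[ℂ] ℂ) : Prop :=
  ∃ f : X →L[ℂ] ℂ, ∀ a : A, δ a = M.dualLact a f - M.dualRact a f

end BanachBimodule

/-- Amenability (in the sense of Johnson) of a complex Banach algebra `A`, unital or not: every
bounded derivation from `A` into the dual of a Banach `A`-bimodule is inner. -/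
def IsAmenableBanachAlgebra (A : Type) [NonUnitalNormedRing A] [NormedSpace ℂ A]
    [IsScalarTower ℂ A A] [SMulCommClass ℂ A A] : Prop :=
  ∀ (X : Type) [NormedAddCommGroup X] [NormedSpace ℂ X] [CompleteSpace X]
    (M : BanachBimodule A X) (δ : A →L[ℂ] X →L[ℂ] ℂ),
    M.IsDualDerivation δ → M.IsDualInner δ

/-- `B` is isomorphic, as a Banach algebra, to a C⋆-algebra (unital or not): there is a bijective
linear multiplicative map onto a C⋆-algebra that is continuous together with its inverse. -/
def IsIsomorphicToCStarAlgebra (B : Type) [NonUnitalNormedRing B] [NormedSpace ℂ B]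
    [IsScalarTower ℂ B B] [SMulCommClass ℂ B B] : Prop :=
  ∃ (D : Type) (_ : NonUnitalCStarAlgebra D) (Φ : B ≃L[ℂ] D), ∀ x y : B, Φ (x * y) = Φ x * Φ y

section KadisonKastler

variable {H : Type*} [NormedAddCommGroup H] [InnerProductSpace ℂ H]

/-- The elements of norm one of a subalgebra of `B(H)`. -/
def unitSphereOf (A : NonUnitalSubalgebra ℂ (H →L[ℂ] H)) : Set (H →L[ℂ] H) :=
  {x | x ∈ A ∧ ‖x‖ = 1}

/-- The Kadison–Kastler distance of two subalgebras of `B(H)`, with values in `[0, ∞]`: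
the supremum and the infimum are the true ones, also for the zero algebra. -/
noncomputable def kadisonKastlerDist (A B : NonUnitalSubalgebra ℂ (H →L[ℂ] H)) : ENNReal :=
  max (⨆ x ∈ unitSphereOf A, ⨅ y ∈ unitSphereOf B, ‖x - y‖ₑ)
    (⨆ x ∈ unitSphereOf B, ⨅ y ∈ unitSphereOf A, ‖x - y‖ₑ)

end KadisonKastler

/-! Two distinct branches of the binary tree share only finitely many nodes. In the `ℓ^∞`-product of
copies of `B(ℂ²)` over the nodes, each branch `x` carries an idempotent `gen t x`: along `x` its
entry is `E₁₁` or `E₁₁ + t E₁₂` according to the next turn of `x`, and elsewhere it is `0`. These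
idempotents and the elements of finite support generate `branchAlgebra t`, which acts diagonally on
a separable Hilbert space. It is nonseparable, since the idempotents of distinct branches are at
distance at least `1`. For `t = 0` it is self-adjoint and serves as `C`; keeping the coefficients
and changing the parameter moves the unit sphere by `O(|t|)` (`exists_near`).

Amenability: finitely many nodes and branches are captured by the span of a finite group bounded by
`1 + |t|`, namely signed permutation matrices on a finite set of nodes containing all crossings, and
signs on the branches elsewhere. Averaging over the group makes a derivation inner there with a
uniform bound, and weak-* compactness passes to the limit (`isAmenableBanachAlgebra_of_directed`).

No C⋆-structure for `t ≠ 0`: if a nonseparable subalgebra were isomorphic to a C⋆-algebra, images of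
self-adjoint elements would survive at infinity along uncountably many branches. A pigeonhole
argument then gives two such elements with nearly equal coefficients on branches that separate late.
At the last common node the image of their difference is almost a multiple of `E₁₂`, whereas
functional calculus keeps images of self-adjoint elements away from nilpotents
(`not_near_nilpotent`, `countable_branches`). -/

open Filter Topology

/-! ### Averaging a derivation over a finite group. -/

namespace BanachBimodule

variable {A X : Type*} [NonUnitalNormedRing A] [NormedSpace ℂ A]
  [IsScalarTower ℂ A A] [SMulCommClass ℂ A A] [NormedAddCommGroup X] [NormedSpace ℂ X]

section

variable (M : BanachBimodule A X)

@[simp] lemma dualLact_apply (a : A) (f : X →L[ℂ] ℂ) (x : X) :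
    M.dualLact a f x = f (M.ract a x) := rfl

@[simp] lemma dualRact_apply (a : A) (f : X →L[ℂ] ℂ) (x : X) :
    M.dualRact a f x = f (M.lact a x) := rfl

lemma norm_dualLact_le (a : A) (f : X →L[ℂ] ℂ) : ‖M.dualLact a f‖ ≤ ‖f‖ * (‖M.ract‖ * ‖a‖) :=
  (ContinuousLinearMap.opNorm_comp_le _ _).trans
    (mul_le_mul_of_nonneg_left (M.ract.le_opNorm a) (norm_nonneg f))

lemma norm_dualRact_le (a : A) (f : X →L[ℂ] ℂ) : ‖M.dualRact a f‖ ≤ ‖f‖ * (‖M.lact‖ * ‖a‖) :=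
  (ContinuousLinearMap.opNorm_comp_le _ _).trans
    (mul_le_mul_of_nonneg_left (M.lact.le_opNorm a) (norm_nonneg f))

/-- The functional implementing a derivation on the span of a finite group `φ`. -/
noncomputable def averageFunctional (δ : A →L[ℂ] X →L[ℂ] ℂ) {U : Type*} [Group U] [Fintype U]
    (φ : U → A) : X →L[ℂ] ℂ :=
  M.dualLact (φ 1) (δ (φ 1)) -
    (Fintype.card U : ℂ)⁻¹ • ∑ u, M.dualRact (φ u⁻¹) (δ (φ u))

variable {M}

/-- The bound does not depend on the group, so the functionals for all groups lie in one weak-*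
compact ball. -/
lemma norm_averageFunctional_le (δ : A →L[ℂ] X →L[ℂ] ℂ) {U : Type*} [Group U] [Fintype U]
    (φ : U → A) {C : ℝ} (hφ : ∀ u, ‖φ u‖ ≤ C) :
    ‖M.averageFunctional δ φ‖ ≤ ‖δ‖ * C * (‖M.ract‖ * C) + ‖δ‖ * C * (‖M.lact‖ * C) := by
  have hC : 0 ≤ C := (norm_nonneg _).trans (hφ 1)
  have hδ : ∀ u, ‖δ (φ u)‖ ≤ ‖δ‖ * C := fun u =>
    (δ.le_opNorm _).trans (mul_le_mul_of_nonneg_left (hφ u) (norm_nonneg δ))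
  refine (norm_sub_le _ _).trans (add_le_add ?_ ?_)
  · refine (M.norm_dualLact_le _ _).trans ?_
    gcongr
    exacts [hδ 1, hφ 1]
  · rw [norm_smul, norm_inv, Complex.norm_natCast]
    have hcard : (0 : ℝ) < Fintype.card U := by exact_mod_cast Fintype.card_pos
    rw [inv_mul_le_iff₀ hcard]
    refine (norm_sum_le_of_le (n := fun _ => ‖δ‖ * C * (‖M.lact‖ * C)) _ fun u _ => ?_).trans ?_
    · refine (M.norm_dualRact_le _ _).trans ?_
      gcongr
      exacts [hδ u, hφ _]
    · simp

/-- Here `e = φ 1` is only an idempotent, so `δ v = v · δ e + δ v · e` has two parts. Johnson's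
average produces `δ v · e`; the extra term `e · δ e` produces `v · δ e` and nothing more, because `e
· δ e · e = 0`. -/
lemma IsDualDerivation.eq_averageFunctional {δ : A →L[ℂ] X →L[ℂ] ℂ} (hδ : M.IsDualDerivation δ)
    {U : Type*} [Group U] [Fintype U] {φ : U → A} (hmul : ∀ u v, φ (u * v) = φ u * φ v) (v : U) :
    δ (φ v) = M.dualLact (φ v) (M.averageFunctional δ φ) -
      M.dualRact (φ v) (M.averageFunctional δ φ) := by
  ext x
  have hder : ∀ a b y, δ (a * b) y = δ b (M.ract a y) + δ a (M.lact b y) := fun a b y => by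
    rw [hδ a b]; rfl
  have hcard : (Fintype.card U : ℂ) ≠ 0 := by exact_mod_cast Fintype.card_ne_zero
  have hv1 : φ v = φ v * φ 1 := by rw [← hmul, mul_one]
  have h1v : φ v = φ 1 * φ v := by rw [← hmul, one_mul]
  have h11 : φ 1 = φ 1 * φ 1 := by rw [← hmul, one_mul]
  have hzero : ∀ y, δ (φ 1) (M.lact (φ 1) (M.ract (φ 1) y)) = 0 := fun y => by
    have h := hder (φ 1) (φ 1) (M.lact (φ 1) (M.ract (φ 1) y))
    have e1 : M.lact (φ 1) (M.lact (φ 1) (M.ract (φ 1) y)) = M.lact (φ 1) (M.ract (φ 1) y) := by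
      rw [← M.lact_mul, ← h11]
    have e2 : M.ract (φ 1) (M.lact (φ 1) (M.ract (φ 1) y)) = M.lact (φ 1) (M.ract (φ 1) y) := by
      rw [← M.lact_ract, ← M.ract_mul, ← h11]
    rw [← h11, e1, e2] at h
    simpa using h
  have hz : δ (φ 1) (M.ract (φ 1) (M.lact (φ v) x)) = 0 := by
    rw [h1v, M.lact_mul, ← M.lact_ract]
    exact hzero _
  have hz' : δ (φ 1) (M.ract (φ 1) (M.ract (φ v) x)) = δ (φ 1) (M.ract (φ v) x) := by
    rw [← M.ract_mul, ← hv1]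
  have havg : ∑ u, δ (φ u) (M.lact (φ u⁻¹) (M.ract (φ v) x)) =
      ∑ u, δ (φ u) (M.lact (φ u⁻¹) (M.lact (φ v) x)) -
        Fintype.card U * δ (φ v) (M.lact (φ 1) x) := by
    -- The derivation rule for `φ (v * u)`, arranged so that the sum over `u` can be translated by
    -- `v`.
    have key : ∀ u, δ (φ u) (M.lact (φ u⁻¹) (M.ract (φ v) x)) =
        δ (φ (v * u)) (M.lact (φ (v * u)⁻¹) (M.lact (φ v) x)) -
          δ (φ v) (M.lact (φ 1) x) := fun u => by
      rw [← M.lact_mul (φ (v * u)⁻¹), ← hmul, mul_inv_rev, inv_mul_cancel_right, hmul v u, hder,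
        ← M.lact_mul, ← hmul, mul_inv_cancel, M.lact_ract]
      ring
    rw [Finset.sum_congr rfl fun u _ => key u, Finset.sum_sub_distrib]
    congr 1
    · exact Fintype.sum_equiv (Equiv.mulLeft v) _ _ fun _ => rfl
    · simp
  have hfin : δ (φ v) x = δ (φ 1) (M.ract (φ v) x) + δ (φ v) (M.lact (φ 1) x) := by
    rw [← hder, ← hv1]
  simp only [averageFunctional, sub_apply, dualLact_apply, dualRact_apply,
    smul_apply, sum_apply, smul_eq_mul, hz, hz', havg]
  rw [hfin]
  field_simp
  ring

end

end BanachBimodule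

/-! ### Amenability from a directed family of finite groups. -/

lemma NonUnitalSubalgebra.apply_eq_zero_of_mem_span {E Y : Type*} [NonUnitalNormedRing E]
    [NormedSpace ℂ E] [AddCommGroup Y] [Module ℂ Y] (S : NonUnitalSubalgebra ℂ E) {T : Set E}
    (hT : T ⊆ S) (f : S →ₗ[ℂ] Y) (hf : ∀ a : S, (a : E) ∈ T → f a = 0) (a : S)
    (ha : (a : E) ∈ Submodule.span ℂ T) : f a = 0 := by
  have h : Submodule.span ℂ T ≤ (LinearMap.ker f).map S.toSubmodule.subtype :=
    Submodule.span_le.2 fun e he => ⟨⟨e, hT he⟩, hf ⟨e, hT he⟩ he, rfl⟩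
  obtain ⟨b, hb, hba⟩ := h ha
  obtain rfl : b = a := Subtype.ext hba
  exact hb

/-- A subalgebra that is the closure of a directed union of spans of uniformly bounded finite
groups is amenable. -/
theorem isAmenableBanachAlgebra_of_directed {E : Type} [NonUnitalNormedRing E] [NormedSpace ℂ E]
    [IsScalarTower ℂ E E] [SMulCommClass ℂ E E] (S : NonUnitalSubalgebra ℂ E)
    {ι : Type*} [SemilatticeSup ι] [Nonempty ι] (T : ι → Set E) (hT : Monotone T)
    (hTS : ∀ i, T i ⊆ S) (hd : ∀ a ∈ S, a ∈ closure (Submodule.span ℂ (⋃ i, T i) : Set E))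
    (C : ℝ) (hU : ∀ i, ∃ (U : Type) (_ : Group U) (_ : Fintype U) (φ : U → E),
      (∀ u v, φ (u * v) = φ u * φ v) ∧ (∀ u, φ u ∈ S) ∧ (∀ u, ‖φ u‖ ≤ C) ∧
      T i ⊆ Submodule.span ℂ (Set.range φ)) :
    IsAmenableBanachAlgebra S := by
  intro X _ _ _ M δ hδ
  set K : ℝ := ‖δ‖ * C * (‖M.ract‖ * C) + ‖δ‖ * C * (‖M.lact‖ * C)
  let Z : ι → Set (WeakDual ℂ X) := fun i =>
    {f | ∀ a : S, (a : E) ∈ T i → ∀ x, δ a x = f (M.ract a x) - f (M.lact a x)}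
  let B : Set (WeakDual ℂ X) := WeakDual.toStrongDual ⁻¹' Metric.closedBall 0 K
  have hBc : IsCompact B := WeakDual.isCompact_closedBall 0 K
  have hZ : ∀ i, IsClosed (Z i) := fun i => by
    simp only [Z, Set.ofPred_forall]
    refine isClosed_iInter fun a => isClosed_iInter fun _ => isClosed_iInter fun x => ?_
    exact isClosed_eq continuous_const
      ((WeakDual.eval_continuous _).sub (WeakDual.eval_continuous _))
  have hne : ∀ i, (Z i ∩ B).Nonempty := fun i => by
    obtain ⟨U, _, _, φ, hmul, hmem, hnorm, hspan⟩ := hU i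
    let ψ : U → S := fun u => ⟨φ u, hmem u⟩
    have hψ : ∀ u v, ψ (u * v) = ψ u * ψ v := fun u v => Subtype.ext (hmul u v)
    let h := M.averageFunctional δ ψ
    refine ⟨WeakDual.toStrongDual.symm h, fun a ha x => ?_, ?_⟩
    · refine sub_eq_zero.1 (S.apply_eq_zero_of_mem_span (T := Set.range φ)
        (by rintro _ ⟨u, rfl⟩; exact hmem u)
        (δ.flip x - (h.comp (M.ract.flip x) - h.comp (M.lact.flip x)) : S →L[ℂ] ℂ).toLinearMap
        ?_ a (hspan ha))
      rintro b ⟨u, hu⟩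
      obtain rfl : ψ u = b := Subtype.ext hu
      refine sub_eq_zero.2 ?_
      exact congrArg (fun g : X →L[ℂ] ℂ => g x) (hδ.eq_averageFunctional hψ u)
    · simp only [B, Set.mem_preimage, LinearEquiv.apply_symm_apply, mem_closedBall_zero_iff]
      exact BanachBimodule.norm_averageFunctional_le δ ψ hnorm
  -- Functionals implementing `δ` on `T i` with norm at most `K` form a decreasing family of
  -- nonempty weak-* compact sets; a common point works on every `T i`.
  obtain ⟨f, hf⟩ := IsCompact.nonempty_iInter_of_directed_nonempty_isCompact_isClosed
    (fun i => Z i ∩ B)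
    (directed_of_isDirected_le fun i j hij g hg =>
      ⟨fun a ha x => hg.1 a (hT hij ha) x, hg.2⟩)
    hne (fun i => hBc.inter_left (hZ i)) (fun i => (hZ i).inter hBc.isClosed)
  have hf' : ∀ i, f ∈ Z i := fun i => (Set.mem_iInter.1 hf i).1
  let g : X →L[ℂ] ℂ := WeakDual.toStrongDual f
  refine ⟨g, fun a => ?_⟩
  ext x
  let Λ : S →L[ℂ] ℂ := δ.flip x - (g.comp (M.ract.flip x) - g.comp (M.lact.flip x))
  suffices hΛ : Λ a = 0 from by
    have := sub_eq_zero.1 hΛ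
    exact this
  have hTS' : (⋃ i, T i) ⊆ S := Set.iUnion_subset hTS
  have hcl : IsClosed {b : S | Λ b = 0} := isClosed_eq Λ.continuous continuous_const
  refine hcl.closure_subset (closure_mono (s := ((↑) : S → E) ⁻¹' Submodule.span ℂ (⋃ i, T i))
    ?_ ?_)
  · intro b hb
    refine S.apply_eq_zero_of_mem_span hTS' Λ.toLinearMap (fun a ha => ?_) b hb
    obtain ⟨i, hi⟩ := Set.mem_iUnion.1 ha
    exact sub_eq_zero.2 (hf' i a hi x)
  · rw [closure_subtype, Set.image_preimage_eq_of_subset]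
    · exact hd a a.2
    · rw [Subtype.range_coe]
      exact Submodule.span_le (p := S.toSubmodule).2 hTS'

/-! ### A quantitative regularity property of self-adjoint elements. -/

/-- For a self-adjoint `t`, the element `u = t (t² + l²)⁻¹` has norm at most `1 / (2 l)`. -/
lemma IsSelfAdjoint.exists_regularized_inverse {D : Type*} [NonUnitalCStarAlgebra D] {t : D}
    (ht : IsSelfAdjoint t) {l : ℝ} (hl : 0 < l) :
    ∃ u : D, ((l ^ 2 : ℝ) : ℂ) • u + u * (t * t) = t ∧ ‖u‖ ≤ 1 / (2 * l) := by
  have hpos : ∀ x : ℝ, x ^ 2 + l ^ 2 ≠ 0 := fun x => by positivity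
  have hcont : Continuous fun x : ℝ => x / (x ^ 2 + l ^ 2) :=
    continuous_id.div (by fun_prop) hpos
  have hc2 : Continuous fun x : ℝ => l ^ 2 • (x / (x ^ 2 + l ^ 2)) := continuous_const.mul hcont
  have hc3 : Continuous fun x : ℝ => x / (x ^ 2 + l ^ 2) * (x * x) := hcont.mul (by fun_prop)
  refine ⟨cfcₙ (fun x : ℝ => x / (x ^ 2 + l ^ 2)) t, ?_, ?_⟩
  · have h1 : t * t = cfcₙ (fun x : ℝ => x * x) t := by
      rw [cfcₙ_mul (fun x : ℝ => x) (fun x : ℝ => x) t, cfcₙ_id' ℝ t]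
    rw [h1, ← cfcₙ_mul _ _ t hcont.continuousOn (by simp) (by fun_prop) (by simp),
      Complex.coe_smul, ← cfcₙ_smul (l ^ 2) _ t hcont.continuousOn (by simp),
      ← cfcₙ_add (fun x : ℝ => l ^ 2 • (x / (x ^ 2 + l ^ 2)))
        (fun x : ℝ => x / (x ^ 2 + l ^ 2) * (x * x)) t hc2.continuousOn (by simp) hc3.continuousOn (by simp)]
    conv_rhs => rw [← cfcₙ_id' ℝ t]
    congr 1
    ext x
    have := hpos x
    simp only [smul_eq_mul]
    field_simp
    ring
  · refine norm_cfcₙ_le fun x _ => ?_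
    rw [Real.norm_eq_abs, abs_div, abs_of_pos (show 0 < x ^ 2 + l ^ 2 by positivity),
      div_le_div_iff₀ (by positivity) (by positivity), ← sq_abs x]
    -- This is `2 |x| l ≤ x² + l²`.
    nlinarith [sq_nonneg (|x| - l)]

/-! ### The algebras built on almost disjoint branches. -/

/-- A projection `proj = E₁₁` and a nilpotent `nil = E₁₂` in a C⋆-algebra, together with the matrix
entry functional of `proj`. -/
structure CornerData (R : Type) [CStarAlgebra R] where
  /-- the projection `E₁₁` -/
  proj : R
  /-- the nilpotent `E₁₂` -/
  nil : R
  /-- the upper left matrix entry -/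
  corner : R →L[ℂ] ℂ
  proj_mul_proj : proj * proj = proj
  proj_mul_nil : proj * nil = nil
  nil_mul_proj : nil * proj = 0
  nil_mul_nil : nil * nil = 0
  star_proj : star proj = proj
  norm_proj_le : ‖proj‖ ≤ 1
  norm_nil_le : ‖nil‖ ≤ 1
  nil_ne_zero : nil ≠ 0
  corner_proj : corner proj = 1
  corner_nil : corner nil = 0
  norm_corner_le : ∀ a, ‖corner a‖ ≤ ‖a‖

/-- The `ℓ^∞`-product of copies of `R` indexed by the nodes of the binary tree. -/
abbrev NodeProd (R : Type) [CStarAlgebra R] : Type := lp (fun _ : List Bool => R) ⊤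

namespace CornerData

noncomputable section

variable {R : Type} [CStarAlgebra R] (K : CornerData R)

/-- The two idempotents `E₁₁` and `E₁₁ + t E₁₂`. -/
def symbol (t : ℂ) (b : Bool) : R := K.proj + (if b then t else 0) • K.nil

lemma symbol_mul_self (t : ℂ) (b : Bool) : K.symbol t b * K.symbol t b = K.symbol t b := by
  simp only [symbol, mul_add, add_mul, smul_mul_assoc, mul_smul_comm, K.proj_mul_proj, K.proj_mul_nil,
    K.nil_mul_proj, K.nil_mul_nil, smul_zero, add_zero]

lemma corner_symbol (t : ℂ) (b : Bool) : K.corner (K.symbol t b) = 1 := by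
  rw [symbol, map_add, map_smul, K.corner_proj, K.corner_nil, smul_zero, add_zero]

lemma norm_symbol_le (t : ℂ) (b : Bool) : ‖K.symbol t b‖ ≤ 1 + ‖t‖ := by
  refine (norm_add_le _ _).trans (add_le_add K.norm_proj_le ?_)
  rw [norm_smul]
  have h : ‖(if b then t else 0 : ℂ)‖ ≤ ‖t‖ := by split_ifs <;> simp
  exact (mul_le_of_le_one_right (norm_nonneg _) K.norm_nil_le).trans h

lemma norm_symbol_sub_le (t u : ℂ) (b : Bool) : ‖K.symbol t b - K.symbol u b‖ ≤ ‖t - u‖ := by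
  have h : K.symbol t b - K.symbol u b = (if b then t - u else 0) • K.nil := by
    cases b <;> simp [symbol, sub_smul]
  rw [h, norm_smul]
  have h : ‖(if b then t - u else 0 : ℂ)‖ ≤ ‖t - u‖ := by split_ifs <;> simp
  exact (mul_le_of_le_one_right (norm_nonneg _) K.norm_nil_le).trans h

lemma star_symbol_zero (b : Bool) : star (K.symbol 0 b) = K.symbol 0 b := by
  simp [symbol, K.star_proj]

/-- Evaluation at a node. -/
def ev (s : List Bool) : NodeProd R →⋆ₙₐ[ℂ] R where
  toFun a := a s
  map_smul' _ _ := rfl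
  map_zero' := rfl
  map_add' _ _ := rfl
  map_mul' _ _ := rfl
  map_star' _ := rfl

lemma ext_ev {a b : NodeProd R} (h : ∀ s, ev s a = ev s b) : a = b := lp.ext (funext h)

lemma norm_le_of_ev {a : NodeProd R} {C : ℝ} (hC : 0 ≤ C) (h : ∀ s, ‖ev s a‖ ≤ C) : ‖a‖ ≤ C :=
  lp.norm_le_of_forall_le hC h

/-- A bounded family of operators as an element of the product. -/
def ofBounded (f : List Bool → R) (C : ℝ) (h : ∀ s, ‖f s‖ ≤ C) : NodeProd R :=
  ⟨f, memℓp_infty ⟨C, by rintro _ ⟨s, rfl⟩; exact h s⟩⟩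

@[simp] lemma ofBounded_apply (f : List Bool → R) (C : ℝ) (h : ∀ s, ‖f s‖ ≤ C)
    (s : List Bool) : ev s (ofBounded f C h) = f s := rfl

lemma norm_ev_le (a : NodeProd R) (s : List Bool) : ‖ev s a‖ ≤ ‖a‖ :=
  lp.norm_apply_le_norm ENNReal.top_ne_zero a s

/-- The node of length `n` on the branch `x`. -/
def node (x : ℕ → Bool) (n : ℕ) : List Bool := (List.range n).map x

/-- The node `s` lies on the branch `x`. -/
def OnBranch (x : ℕ → Bool) (s : List Bool) : Prop := node x s.length = s

@[simp] lemma length_node (x : ℕ → Bool) (n : ℕ) : (node x n).length = n := by simp [node]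

lemma onBranch_node (x : ℕ → Bool) (n : ℕ) : OnBranch x (node x n) := by simp [OnBranch]

lemma node_eq_node_iff {x y : ℕ → Bool} {n : ℕ} : node x n = node y n ↔ ∀ i < n, x i = y i := by
  simp [node, List.map_inj_left]

lemma node_injective (x : ℕ → Bool) : Function.Injective (node x) := fun m n h => by
  simpa using congrArg List.length h

lemma tendsto_node (x : ℕ → Bool) : Tendsto (node x) atTop cofinite :=
  Nat.cofinite_eq_atTop ▸ (node_injective x).tendsto_cofinite

lemma eventually_not_onBranch {x y : ℕ → Bool} (h : x ≠ y) :
    ∀ᶠ s in cofinite, ¬(OnBranch x s ∧ OnBranch y s) := by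
  obtain ⟨i, hi⟩ := Function.ne_iff.1 h
  refine (List.finite_length_lt Bool (i + 1)).subset fun s hs => ?_
  obtain ⟨hx, hy⟩ := not_not.1 hs
  by_contra hlt
  exact hi (node_eq_node_iff.1 (hx.trans hy.symm) i (by simpa using hlt))

/-- The branches in `F` are disjoint at the node `s`. -/
def DisjointAt (F : Finset (ℕ → Bool)) (s : List Bool) : Prop :=
  ∀ x ∈ F, ∀ y ∈ F, x ≠ y → ¬(OnBranch x s ∧ OnBranch y s)

lemma eventually_disjointAt (F : Finset (ℕ → Bool)) : ∀ᶠ s in cofinite, DisjointAt F s := by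
  simp only [DisjointAt, eventually_all_finset]
  intro x _ y _
  by_cases h : x = y
  · simp [h]
  · filter_upwards [eventually_not_onBranch h] with s hs _ using hs

open Classical in
/-- The idempotent supported on the branch `x`, with value prescribed by the next turn of `x`. -/
def gen (t : ℂ) (x : ℕ → Bool) : NodeProd R :=
  ofBounded (fun s => if OnBranch x s then K.symbol t (x s.length) else 0) (1 + ‖t‖) fun s => by
    split_ifs
    · exact K.norm_symbol_le t _
    · rw [norm_zero]; positivity

lemma gen_apply_of_onBranch {t : ℂ} {x : ℕ → Bool} {s : List Bool} (h : OnBranch x s) :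
    ev s (K.gen t x) = K.symbol t (x s.length) := by simp [gen, h]

lemma gen_apply_of_not {t : ℂ} {x : ℕ → Bool} {s : List Bool} (h : ¬OnBranch x s) :
    ev s (K.gen t x) = 0 := by simp [gen, h]

/-- A finite linear combination of the idempotents `gen t x`. -/
def comb (t : ℂ) : ((ℕ → Bool) →₀ ℂ) →ₗ[ℂ] NodeProd R := Finsupp.linearCombination ℂ (K.gen t)

lemma comb_single (t : ℂ) (x : ℕ → Bool) (z : ℂ) : K.comb t (Finsupp.single x z) = z • K.gen t x :=
  Finsupp.linearCombination_single _ _ _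

lemma comb_apply {t : ℂ} {c : (ℕ → Bool) →₀ ℂ} {F : Finset (ℕ → Bool)} (h : c.support ⊆ F)
    (s : List Bool) : ev s (K.comb t c) = ∑ x ∈ F, c x • ev s (K.gen t x) := by
  rw [comb, Finsupp.linearCombination_apply, Finsupp.sum_of_support_subset _ h _ (by simp),
    map_sum]
  simp only [map_smul]

lemma comb_apply_of_onBranch {t : ℂ} {c : (ℕ → Bool) →₀ ℂ} {F : Finset (ℕ → Bool)}
    (h : c.support ⊆ F) {s : List Bool} (hs : DisjointAt F s) {x : ℕ → Bool} (hx : x ∈ F)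
    (hxs : OnBranch x s) : ev s (K.comb t c) = c x • K.symbol t (x s.length) := by
  rw [K.comb_apply h, Finset.sum_eq_single_of_mem x hx, K.gen_apply_of_onBranch hxs]
  intro y hy hyx
  rw [K.gen_apply_of_not fun hys => hs y hy x hx hyx ⟨hys, hxs⟩, smul_zero]

lemma comb_apply_of_not {t : ℂ} {c : (ℕ → Bool) →₀ ℂ} {F : Finset (ℕ → Bool)}
    (h : c.support ⊆ F) {s : List Bool} (hs : ∀ x ∈ F, ¬OnBranch x s) : ev s (K.comb t c) = 0 := by
  rw [K.comb_apply h]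
  exact Finset.sum_eq_zero fun x hx => by rw [K.gen_apply_of_not (hs x hx), smul_zero]

lemma eventually_comb_node (t : ℂ) (c : (ℕ → Bool) →₀ ℂ) (x : ℕ → Bool) :
    ∀ᶠ n in atTop, ev (node x n) (K.comb t c) = c x • K.symbol t (x n) := by
  classical
  filter_upwards [(tendsto_node x).eventually (eventually_disjointAt (insert x c.support))]
    with n hn
  rw [K.comb_apply_of_onBranch (Finset.subset_insert _ _) hn (Finset.mem_insert_self _ _)
    (onBranch_node x n), length_node]

/-- At most one branch of `F` passes through `s`, and the entry it carries is idempotent, so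
coefficients multiply pointwise. -/
lemma comb_mul_apply {t : ℂ} {c d : (ℕ → Bool) →₀ ℂ} {F : Finset (ℕ → Bool)}
    (hc : c.support ⊆ F) (hd : d.support ⊆ F) {s : List Bool} (hs : DisjointAt F s) :
    ev s (K.comb t (c * d)) = ev s (K.comb t c) * ev s (K.comb t d) := by
  have hcd : (c * d).support ⊆ F := fun x hx => hc <| by
    simp only [Finsupp.mem_support_iff, Finsupp.mul_apply] at hx ⊢
    exact left_ne_zero_of_mul hx
  by_cases h : ∃ x ∈ F, OnBranch x s
  · obtain ⟨x, hx, hxs⟩ := h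
    rw [K.comb_apply_of_onBranch hc hs hx hxs, K.comb_apply_of_onBranch hd hs hx hxs,
      K.comb_apply_of_onBranch hcd hs hx hxs, smul_mul_smul_comm, K.symbol_mul_self,
      Finsupp.mul_apply]
  · push Not at h
    rw [K.comb_apply_of_not hc h, K.comb_apply_of_not hcd h, zero_mul]

lemma norm_comb_apply_le {t : ℂ} {c : (ℕ → Bool) →₀ ℂ} {F : Finset (ℕ → Bool)}
    (hc : c.support ⊆ F) {s : List Bool} (hs : DisjointAt F s) {C : ℝ} (hC : 0 ≤ C)
    (h : ∀ x, ‖c x‖ ≤ C) : ‖ev s (K.comb t c)‖ ≤ C * (1 + ‖t‖) := by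
  by_cases hx : ∃ x ∈ F, OnBranch x s
  · obtain ⟨x, hx, hxs⟩ := hx
    rw [K.comb_apply_of_onBranch hc hs hx hxs, norm_smul]
    exact mul_le_mul (h x) (K.norm_symbol_le t _) (norm_nonneg _) hC
  · push Not at hx
    rw [K.comb_apply_of_not hc hx, norm_zero]
    positivity

/-- The algebra of all finite linear combinations of the `gen t x`, up to changes at finitely many
nodes. -/
def coreAlgebra (t : ℂ) : NonUnitalSubalgebra ℂ (NodeProd R) where
  carrier := {a | ∃ c, ∀ᶠ s in cofinite, ev s a = ev s (K.comb t c)}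
  zero_mem' := ⟨0, by simp⟩
  add_mem' := by
    rintro a b ⟨c, hc⟩ ⟨d, hd⟩
    refine ⟨c + d, ?_⟩
    filter_upwards [hc, hd] with s hcs hds
    rw [map_add, hcs, hds, map_add, map_add]
  smul_mem' := by
    rintro z a ⟨c, hc⟩
    refine ⟨z • c, ?_⟩
    filter_upwards [hc] with s hcs
    rw [map_smul, hcs, map_smul, map_smul]
  mul_mem' := by
    classical
    rintro a b ⟨c, hc⟩ ⟨d, hd⟩
    refine ⟨c * d, ?_⟩
    filter_upwards [hc, hd, eventually_disjointAt (c.support ∪ d.support)] with s hcs hds hs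
    rw [map_mul, hcs, hds,
      K.comb_mul_apply Finset.subset_union_left Finset.subset_union_right hs]

/-- The closure of `coreAlgebra t`. -/
def branchAlgebra (t : ℂ) : NonUnitalSubalgebra ℂ (NodeProd R) := (K.coreAlgebra t).topologicalClosure

lemma coreAlgebra_le (t : ℂ) : K.coreAlgebra t ≤ K.branchAlgebra t :=
  NonUnitalSubalgebra.le_topologicalClosure _

lemma isClosed_branchAlgebra (t : ℂ) : IsClosed (K.branchAlgebra t : Set (NodeProd R)) :=
  NonUnitalSubalgebra.isClosed_topologicalClosure _

lemma exists_mem_coreAlgebra {t : ℂ} {a : NodeProd R} (ha : a ∈ K.branchAlgebra t) {δ : ℝ}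
    (hδ : 0 < δ) : ∃ b ∈ K.coreAlgebra t, ‖a - b‖ < δ := by
  obtain ⟨b, hb, h⟩ := Metric.mem_closure_iff.1 ha δ hδ
  exact ⟨b, hb, by rwa [← dist_eq_norm]⟩

lemma gen_mem (t : ℂ) (x : ℕ → Bool) : K.gen t x ∈ K.coreAlgebra t :=
  ⟨Finsupp.single x 1, by simp [comb_single]⟩

/-- Far out along `x` only the term of `x` is left, and `corner` reads off its coefficient because
it is `1` on both symbols. -/
lemma norm_coeff_le {t : ℂ} {a : NodeProd R} {c : (ℕ → Bool) →₀ ℂ}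
    (h : ∀ᶠ s in cofinite, ev s a = ev s (K.comb t c)) (x : ℕ → Bool) {C : ℝ}
    (hC : ∀ᶠ n in atTop, ‖ev (node x n) a‖ ≤ C) : ‖c x‖ ≤ C := by
  obtain ⟨n, ⟨h1, h2⟩, h3⟩ := ((hC.and ((tendsto_node x).eventually h)).and
    (K.eventually_comb_node t c x)).exists
  calc ‖c x‖ = ‖K.corner (ev (node x n) a)‖ := by
        rw [h2, h3, map_smul, K.corner_symbol, smul_eq_mul, mul_one]
    _ ≤ _ := (K.norm_corner_le _).trans h1

/-- Elements of `branchAlgebra t` are asymptotically multiples of `gen t x` along `x`. -/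
lemma exists_tendsto_node {t : ℂ} {a : NodeProd R} (ha : a ∈ K.branchAlgebra t) (x : ℕ → Bool) :
    ∃ z : ℂ, Tendsto (fun n => ev (node x n) a - z • K.symbol t (x n)) atTop (𝓝 0) := by
  have happ : ∀ δ > 0, ∃ z : ℂ, ∀ᶠ n in atTop, ‖ev (node x n) a - z • K.symbol t (x n)‖ ≤ δ := by
    intro δ hδ
    obtain ⟨b, ⟨c, hc⟩, hb⟩ := K.exists_mem_coreAlgebra ha hδ
    refine ⟨c x, ?_⟩
    filter_upwards [(tendsto_node x).eventually hc, K.eventually_comb_node t c x] with n h1 h2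
    rw [← h2, ← h1, ← map_sub]
    exact (norm_ev_le (a - b) _).trans hb.le
  have hcorner : ∀ (z : ℂ) n,
      ‖K.corner (ev (node x n) a) - z‖ ≤ ‖ev (node x n) a - z • K.symbol t (x n)‖ := fun z n => by
    simpa [K.corner_symbol] using K.norm_corner_le (ev (node x n) a - z • K.symbol t (x n))
  -- The candidate coefficient is the limit of the corners, which does not depend on the turns of
  -- `x`.
  have hcau : CauchySeq fun n => K.corner (ev (node x n) a) := by
    refine Metric.cauchySeq_iff'.2 fun ε hε => ?_
    obtain ⟨z, hz⟩ := happ (ε / 3) (by positivity)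
    obtain ⟨N, hN⟩ := eventually_atTop.1 hz
    refine ⟨N, fun n hn => ?_⟩
    have h1 := (hcorner z n).trans (hN n hn)
    have h2 := (hcorner z N).trans (hN N le_rfl)
    rw [dist_eq_norm]
    calc _ = ‖(K.corner (ev (node x n) a) - z) - (K.corner (ev (node x N) a) - z)‖ := by congr 1; ring
      _ ≤ ε / 3 + ε / 3 := (norm_sub_le _ _).trans (add_le_add h1 h2)
      _ < ε := by linarith
  obtain ⟨w, hw⟩ := cauchySeq_tendsto_of_complete hcau
  refine ⟨w, Metric.tendsto_nhds.2 fun ε hε => ?_⟩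
  -- With `δ` this tolerance, the total error is `δ + δ (1 + ‖t‖) = ε / 2`.
  obtain ⟨z, hz⟩ := happ (ε / (2 * (2 + ‖t‖))) (by positivity)
  have hzw : ‖z - w‖ ≤ ε / (2 * (2 + ‖t‖)) := by
    refine le_of_tendsto (tendsto_const_nhds.sub hw).norm ?_
    filter_upwards [hz] with n hn
    rw [norm_sub_rev]
    exact (hcorner z n).trans hn
  filter_upwards [hz] with n hn
  rw [dist_zero_right]
  calc _ = ‖(ev (node x n) a - z • K.symbol t (x n)) + (z - w) • K.symbol t (x n)‖ := by
        rw [sub_smul]; congr 1; abel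
    _ ≤ ε / (2 * (2 + ‖t‖)) + ε / (2 * (2 + ‖t‖)) * (1 + ‖t‖) := by
        refine (norm_add_le _ _).trans (add_le_add hn ?_)
        rw [norm_smul]
        exact mul_le_mul hzw (K.norm_symbol_le _ _) (norm_nonneg _) (by positivity)
    _ = ε / 2 := by field_simp; ring
    _ < ε := by linarith

end

end CornerData

/-! ### Separable pieces and nonseparability. -/

namespace CornerData

noncomputable section

variable {R : Type} [CStarAlgebra R] (K : CornerData R)

/-- The element supported at one node. -/
def single (s : List Bool) : R →ₗ[ℂ] NodeProd R where
  toFun m := lp.single (E := fun _ : List Bool => R) ⊤ s m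
  map_add' m n := lp.single_add (E := fun _ : List Bool => R) ⊤ s m n
  map_smul' z m := lp.single_smul (E := fun _ : List Bool => R) ⊤ s z m

lemma ev_single_self (s : List Bool) (m : R) : ev s (single (R := R) s m) = m :=
  lp.single_apply_self (E := fun _ : List Bool => R) ⊤ s m

lemma ev_single_of_ne {s s' : List Bool} (h : s' ≠ s) (m : R) : ev s' (single (R := R) s m) = 0 :=
  lp.single_apply_ne (E := fun _ : List Bool => R) ⊤ s m h

/-- The restriction of an element to the complement of a finite set of nodes. -/
def off (G : Finset (List Bool)) (a : NodeProd R) : NodeProd R :=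
  ofBounded (fun s => if s ∈ G then 0 else ev s a) ‖a‖ fun s => by
    split_ifs
    · simp
    · exact norm_ev_le a s

lemma ev_off_of_mem {G : Finset (List Bool)} {s : List Bool} (h : s ∈ G) (a : NodeProd R) :
    ev s (off G a) = 0 := by simp [off, h]

lemma ev_off_of_notMem {G : Finset (List Bool)} {s : List Bool} (h : s ∉ G) (a : NodeProd R) :
    ev s (off G a) = ev s a := by simp [off, h]

lemma eventually_ev_off (G : Finset (List Bool)) (a : NodeProd R) :
    ∀ᶠ s in cofinite, ev s (off G a) = ev s a := by
  filter_upwards [G.eventually_cofinite_notMem] with s hs using ev_off_of_notMem hs a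

lemma norm_off_le {G : Finset (List Bool)} {a : NodeProd R} {C : ℝ} (hC : 0 ≤ C)
    (h : ∀ s ∉ G, ‖ev s a‖ ≤ C) : ‖off G a‖ ≤ C := by
  refine norm_le_of_ev hC fun s => ?_
  by_cases hs : s ∈ G
  · simpa [ev_off_of_mem hs] using hC
  · rw [ev_off_of_notMem hs]
    exact h s hs

lemma eq_off_add_sum (G : Finset (List Bool)) (a : NodeProd R) :
    a = off G a + ∑ s ∈ G, single (R := R) s (ev s a) := by
  refine ext_ev fun s => ?_
  rw [map_add, map_sum]
  by_cases hs : s ∈ G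
  · rw [ev_off_of_mem hs, zero_add, Finset.sum_eq_single_of_mem s hs, ev_single_self]
    intro s' _ h
    exact ev_single_of_ne h.symm _
  · rw [ev_off_of_notMem hs, Finset.sum_eq_zero, add_zero]
    intro s' hs'
    exact ev_single_of_ne (fun h : s = s' => hs (h ▸ hs')) _

lemma exists_disjointAt (F : Finset (ℕ → Bool)) :
    ∃ G : Finset (List Bool), ∀ s ∉ G, DisjointAt F s :=
  ⟨(eventually_cofinite.1 (eventually_disjointAt F)).toFinset, fun s hs => by simpa using hs⟩

lemma eventually_ev_single (s : List Bool) (m : R) : ∀ᶠ s' in cofinite, ev s' (single (R := R) s m) = 0 := by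
  filter_upwards [(Set.finite_singleton s).eventually_cofinite_notMem] with s' h
    using ev_single_of_ne h m

lemma single_mem (t : ℂ) (s : List Bool) (m : R) : single (R := R) s m ∈ K.coreAlgebra t :=
  ⟨0, by filter_upwards [eventually_ev_single s m] with s' h; simpa using h⟩

/-- The elements supported at one node, and the idempotents of the branches in `U`. -/
def generators (t : ℂ) (U : Set (ℕ → Bool)) : Set (NodeProd R) :=
  (⋃ s, Set.range (single (R := R) s)) ∪ K.gen t '' U

lemma generators_subset (t : ℂ) (U : Set (ℕ → Bool)) :
    K.generators t U ⊆ (K.coreAlgebra t : Set (NodeProd R)) := by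
  rintro a (ha | ⟨x, _, rfl⟩)
  · obtain ⟨s, m, rfl⟩ := Set.mem_iUnion.1 ha
    exact K.single_mem t s m
  · exact K.gen_mem t x

lemma mem_span_generators {t : ℂ} {U : Set (ℕ → Bool)} {a : NodeProd R} {c : (ℕ → Bool) →₀ ℂ}
    (hc : ∀ x ∉ U, c x = 0) (h : ∀ᶠ s in cofinite, ev s a = ev s (K.comb t c)) :
    a ∈ Submodule.span ℂ (K.generators t U) := by
  have h0 : off (eventually_cofinite.1 h).toFinset (a - K.comb t c) = 0 := by
    refine norm_le_zero_iff.1 (norm_off_le le_rfl fun s hs => ?_)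
    rw [map_sub, norm_le_zero_iff, sub_eq_zero]
    simpa using hs
  have h1 := eq_off_add_sum (eventually_cofinite.1 h).toFinset (a - K.comb t c)
  rw [h0, zero_add, sub_eq_iff_eq_add] at h1
  rw [h1]
  refine add_mem (sum_mem fun s _ => Submodule.subset_span (Or.inl ?_)) ?_
  · exact Set.mem_iUnion.2 ⟨s, _, rfl⟩
  · rw [comb, Finsupp.linearCombination_apply]
    refine sum_mem fun x hx => Submodule.smul_mem _ _ (Submodule.subset_span (Or.inr ⟨x, ?_, rfl⟩))
    by_contra hxU
    exact Finsupp.mem_support_iff.1 hx (hc x hxU)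

lemma branchAlgebra_subset_closure_span (t : ℂ) {a : NodeProd R} (ha : a ∈ K.branchAlgebra t) :
    a ∈ closure (Submodule.span ℂ (K.generators t Set.univ) : Set (NodeProd R)) := by
  refine Metric.mem_closure_iff.2 fun ε hε => ?_
  obtain ⟨b, ⟨c, hc⟩, hb⟩ := K.exists_mem_coreAlgebra ha hε
  exact ⟨b, K.mem_span_generators (fun x hx => absurd (Set.mem_univ x) hx) hc,
    by rwa [dist_eq_norm]⟩

/-- In a core approximant the coefficients outside `U` are small. Off the finitely many crossings
their contribution has norm governed by the largest coefficient, not by the sum, so deleting it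
there costs little. -/
lemma mem_closure_span_generators {t : ℂ} {a : NodeProd R} (ha : a ∈ K.branchAlgebra t)
    {U : Set (ℕ → Bool)}
    (hU : ∀ x ∉ U, Tendsto (fun n => ev (node x n) a) atTop (𝓝 0)) :
    a ∈ closure (Submodule.span ℂ (K.generators t U) : Set (NodeProd R)) := by
  classical
  refine Metric.mem_closure_iff.2 fun ε hε => ?_
  set δ := ε / (4 + 2 * ‖t‖) with hδ
  have hδ0 : 0 < δ := by positivity
  obtain ⟨b, ⟨c, hc⟩, hb⟩ := K.exists_mem_coreAlgebra ha hδ0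
  set c' := c.filter (· ∉ U) with hc'
  have hsmall : ∀ x, ‖c' x‖ ≤ 2 * δ := fun x => by
    by_cases hx : x ∈ U
    · rw [hc', Finsupp.filter_apply_neg (· ∉ U) _ (not_not.2 hx), norm_zero]
      positivity
    · rw [hc', Finsupp.filter_apply_pos (· ∉ U) _ hx]
      refine K.norm_coeff_le hc x ?_
      filter_upwards [(hU x hx).norm.eventually_lt_const (by simpa using hδ0)] with n hn
      calc ‖ev (node x n) b‖ = ‖ev (node x n) a - ev (node x n) (a - b)‖ := by
            rw [map_sub, sub_sub_cancel]
        _ ≤ δ + δ := (norm_sub_le _ _).trans (add_le_add hn.le ((norm_ev_le _ _).trans hb.le))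
        _ = 2 * δ := by ring
  obtain ⟨G, hG⟩ := exists_disjointAt c.support
  have hsupp : c'.support ⊆ c.support := by
    rw [hc', Finsupp.support_filter]
    exact Finset.filter_subset _ _
  refine ⟨b - off G (K.comb t c'), K.mem_span_generators (c := c - c') ?_ ?_, ?_⟩
  · intro x hx
    rw [Finsupp.sub_apply, hc', Finsupp.filter_apply_pos (· ∉ U) _ hx, sub_self]
  · filter_upwards [hc, eventually_ev_off G (K.comb t c')] with s h1 h2
    rw [map_sub, h1, h2, map_sub, map_sub]
  · have h1 : ‖off G (K.comb t c')‖ ≤ 2 * δ * (1 + ‖t‖) :=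
      norm_off_le (by positivity) fun s hs =>
        K.norm_comb_apply_le hsupp (hG s hs) (by positivity) hsmall
    rw [dist_eq_norm, ← sub_add]
    calc _ ≤ ‖a - b‖ + ‖off G (K.comb t c')‖ := norm_add_le _ _
      _ < δ + 2 * δ * (1 + ‖t‖) := add_lt_add_of_lt_of_le hb h1
      _ = δ * (3 + 2 * ‖t‖) := by ring
      _ ≤ δ * (4 + 2 * ‖t‖) := by gcongr; norm_num
      _ = ε := by rw [hδ]; field_simp

lemma isSeparable_generators [TopologicalSpace.SeparableSpace R] (t : ℂ) {U : Set (ℕ → Bool)}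
    (hU : U.Countable) : TopologicalSpace.IsSeparable (K.generators t U) := by
  refine (TopologicalSpace.IsSeparable.iUnion fun s => ?_).union (hU.image _).isSeparable
  exact TopologicalSpace.isSeparable_range (lp.isometry_single (E := fun _ : List Bool => R)
    (p := ⊤) s).continuous

/-- The elements of `branchAlgebra t` that vanish at infinity along all but countably many branches
form a separable set. -/
lemma isSeparable_of_tendsto [TopologicalSpace.SeparableSpace R] (t : ℂ) {U : Set (ℕ → Bool)}
    (hU : U.Countable) : TopologicalSpace.IsSeparable {a | a ∈ K.branchAlgebra t ∧
      ∀ x ∉ U, Tendsto (fun n => ev (node x n) a) atTop (𝓝 0)} :=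
  (K.isSeparable_generators t hU).span.closure.mono fun _ ha =>
    K.mem_closure_span_generators ha.1 ha.2

lemma norm_gen_sub_gen_ge {t : ℂ} {x y : ℕ → Bool} (h : x ≠ y) :
    1 ≤ ‖K.gen t x - K.gen t y‖ := by
  obtain ⟨n, hn⟩ := ((tendsto_node x).eventually (eventually_not_onBranch h)).exists
  have h1 := norm_ev_le (K.gen t x - K.gen t y) (node x n)
  rw [map_sub, K.gen_apply_of_onBranch (onBranch_node x n),
    K.gen_apply_of_not fun hy => hn ⟨onBranch_node x n, hy⟩, sub_zero] at h1
  refine le_trans ?_ h1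
  simpa [K.corner_symbol] using K.norm_corner_le (K.symbol t (x (node x n).length))

lemma not_isSeparable_branchAlgebra (t : ℂ) :
    ¬TopologicalSpace.IsSeparable (K.branchAlgebra t : Set (NodeProd R)) := by
  rintro ⟨S, hS, hcl⟩
  have hex : ∀ x : ℕ → Bool, ∃ b ∈ S, dist (K.gen t x) b < 1 / 2 := fun x =>
    Metric.mem_closure_iff.1 (hcl (K.coreAlgebra_le t (K.gen_mem t x))) _ (by norm_num)
  choose f hf hdist using hex
  have hinj : Function.Injective fun x => (⟨f x, hf x⟩ : S) := fun x y hxy => by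
    have hxy : f x = f y := congrArg Subtype.val hxy
    by_contra hne
    have h1 := K.norm_gen_sub_gen_ge (t := t) hne
    rw [← dist_eq_norm] at h1
    have h2 := dist_triangle_right (K.gen t x) (K.gen t y) (f x)
    have h3 := hdist x
    have h4 := hdist y
    rw [← hxy] at h4
    linarith
  have := hS.to_subtype
  have hc : Countable (ℕ → Bool) := hinj.countable
  -- Cantor's diagonal argument.
  obtain ⟨g, hg⟩ := exists_surjective_nat (ℕ → Bool)
  obtain ⟨n, hn⟩ := hg fun n => !g n n
  simpa using congrFun hn n

end

end CornerData

/-! ### The obstruction to being a C⋆-algebra. -/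

namespace CornerData

noncomputable section

variable {R : Type} [CStarAlgebra R] (K : CornerData R)

/-- Taking the coefficient from a countable dense sequence prepares the pigeonhole argument; the
error is relative to its size since the coefficients have no uniform lower bound. -/
lemma exists_approx {t : ℂ} {a : NodeProd R} (ha : a ∈ K.branchAlgebra t) {x : ℕ → Bool}
    (h : ¬Tendsto (fun n => ev (node x n) a) atTop (𝓝 0)) {δ : ℝ} (hδ : 0 < δ) :
    ∃ k N : ℕ, TopologicalSpace.denseSeq ℂ k ≠ 0 ∧ ∀ n ≥ N,
      ‖ev (node x n) a - TopologicalSpace.denseSeq ℂ k • K.symbol t (x n)‖ ≤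
        δ * ‖TopologicalSpace.denseSeq ℂ k‖ := by
  obtain ⟨w, hw⟩ := K.exists_tendsto_node ha x
  have hw0 : w ≠ 0 := by
    rintro rfl
    exact h (by simpa using hw)
  have hopen : IsOpen {z : ℂ | ‖w - z‖ * (1 + ‖t‖) < δ * ‖z‖} :=
    isOpen_lt (by fun_prop) (by fun_prop)
  obtain ⟨z, hz, k, rfl⟩ := (TopologicalSpace.denseRange_denseSeq ℂ).inter_open_nonempty _ hopen
    ⟨w, by simpa using mul_pos hδ (norm_pos_iff.2 hw0)⟩
  set z := TopologicalSpace.denseSeq ℂ k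
  replace hz : ‖w - z‖ * (1 + ‖t‖) < δ * ‖z‖ := hz
  obtain ⟨N, hN⟩ := eventually_atTop.1
    (hw.norm.eventually_lt_const (u := δ * ‖z‖ - ‖w - z‖ * (1 + ‖t‖)) (by simpa using hz))
  refine ⟨k, N, ?_, fun n hn => ?_⟩
  · intro hz0
    simp only [z, hz0, norm_zero, mul_zero, sub_zero] at hz
    exact absurd hz (not_lt.2 (by positivity))
  · calc _ = ‖(ev (node x n) a - w • K.symbol t (x n)) + (w - z) • K.symbol t (x n)‖ := by
          rw [sub_smul]; congr 1; abel
      _ ≤ (δ * ‖z‖ - ‖w - z‖ * (1 + ‖t‖)) + ‖w - z‖ * (1 + ‖t‖) := by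
          refine (norm_add_le _ _).trans (add_le_add (hN n hn).le ?_)
          rw [norm_smul]
          gcongr
          exact K.norm_symbol_le _ _
      _ = _ := by ring

lemma exists_split {x y : ℕ → Bool} (h : x ≠ y) {N : ℕ} (hN : node x N = node y N) :
    ∃ n ≥ N, node x n = node y n ∧ x n ≠ y n := by
  classical
  have hex := Function.ne_iff.1 h
  refine ⟨Nat.find hex, ?_, ?_, Nat.find_spec hex⟩
  · by_contra hlt
    exact Nat.find_spec hex (node_eq_node_iff.1 hN _ (not_le.1 hlt))
  · exact node_eq_node_iff.2 fun i hi => not_not.1 (Nat.find_min hex hi)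

/-- The two symbols differ by `± t E₁₂`, the nilpotent behind the contradiction. -/
lemma symbol_sub_symbol (t : ℂ) {b b' : Bool} (h : b ≠ b') :
    ‖K.symbol t b - K.symbol t b'‖ = ‖t‖ * ‖K.nil‖ ∧
      (K.symbol t b - K.symbol t b') * (K.symbol t b - K.symbol t b') = 0 := by
  have hs : ∃ z : ℂ, ‖z‖ = ‖t‖ ∧ K.symbol t b - K.symbol t b' = z • K.nil := by
    cases b <;> cases b' <;> first | exact absurd rfl h | skip
    · exact ⟨-t, by simp, by simp [symbol]⟩
    · exact ⟨t, rfl, by simp [symbol]⟩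
  obtain ⟨z, hz, hzn⟩ := hs
  rw [hzn]
  exact ⟨by rw [norm_smul, hz], by rw [smul_mul_smul_comm, K.nil_mul_nil, smul_zero]⟩

/-- The image of a self-adjoint element under a bounded homomorphism is not too close to a
nonzero multiple of an element of square zero. -/
lemma not_near_nilpotent {D : Type*} [NonUnitalCStarAlgebra D] (A : D →ₙₐ[ℂ] NodeProd R)
    {C : ℝ} (hC : 0 < C) (hA : ∀ d, ‖A d‖ ≤ C * ‖d‖) {d : D} (hd : IsSelfAdjoint d)
    (s : List Bool) {ν : R} (hν : ν * ν = 0) {δ Z : ℝ} (hδ : 0 < δ) (hZ : 0 < Z)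
    (hνδ : ‖ν‖ = 16 * (1 + C ^ 2) * δ) {z : ℂ} (hz : ‖z‖ = Z) :
    2 * (δ * Z) < ‖ev s (A d) - z • ν‖ := by
  by_contra! hle
  set ω := ‖ν‖
  have hω : 0 < ω := by rw [hνδ]; positivity
  set v := ev s (A d) with hv
  set e := v - z • ν with he
  have hve : v = z • ν + e := by rw [he]; abel
  have hzν : ‖z • ν‖ = Z * ω := by rw [norm_smul, hz]
  have h1 : Z * ω - 2 * (δ * Z) ≤ ‖v‖ := by
    have := norm_sub_le v e
    rw [show v - e = z • ν by rw [he]; abel, hzν] at this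
    linarith
  have hvv : ‖v * v‖ ≤ Z ^ 2 * (4 * δ * ω + 4 * δ ^ 2) := by
    have hexp : v * v = (z • ν) * e + e * (z • ν) + e * e := by
      rw [hve, add_mul, mul_add, mul_add, smul_mul_smul_comm, hν, smul_zero, zero_add, add_assoc]
    rw [hexp]
    calc _ ≤ ‖z • ν‖ * ‖e‖ + ‖e‖ * ‖z • ν‖ + ‖e‖ * ‖e‖ :=
          (norm_add₃_le).trans (add_le_add_three (norm_mul_le _ _) (norm_mul_le _ _)
            (norm_mul_le _ _))
      _ ≤ Z * ω * (2 * (δ * Z)) + 2 * (δ * Z) * (Z * ω) + 2 * (δ * Z) * (2 * (δ * Z)) := by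
          rw [hzν]; gcongr
      _ = _ := by ring
  -- In `v = l² u + u v²` the first term has norm at most `C l / 2`; this `l` makes that `Z ω / 4`,
  -- well below `‖v‖ ≈ Z ω`, while `v²` is small because `ν² = 0`.
  have hl : 0 < Z * ω / (2 * C) := by positivity
  obtain ⟨u, hu, hun⟩ := hd.exists_regularized_inverse hl
  set l := Z * ω / (2 * C) with hldef
  have hul : ‖ev s (A u)‖ ≤ C * (1 / (2 * l)) :=
    (norm_ev_le _ _).trans ((hA u).trans (by gcongr))
  have hkey : ((l ^ 2 : ℝ) : ℂ) • ev s (A u) + ev s (A u) * (v * v) = v := by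
    have := congrArg (fun w => ev s (A w)) hu
    simpa only [map_add, map_smul, map_mul] using this
  have h2 : ‖v‖ ≤ C * (1 / (2 * l)) * (l ^ 2 + Z ^ 2 * (4 * δ * ω + 4 * δ ^ 2)) := by
    calc ‖v‖ = ‖((l ^ 2 : ℝ) : ℂ) • ev s (A u) + ev s (A u) * (v * v)‖ := by rw [hkey]
      _ ≤ l ^ 2 * ‖ev s (A u)‖ + ‖ev s (A u)‖ * ‖v * v‖ := by
          refine (norm_add_le _ _).trans (add_le_add ?_ (norm_mul_le _ _))
          rw [norm_smul, Complex.norm_real, Real.norm_of_nonneg (by positivity)]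
      _ = ‖ev s (A u)‖ * (l ^ 2 + ‖v * v‖) := by ring
      _ ≤ _ := by gcongr
  have h3 : C * (1 / (2 * l)) * (l ^ 2 + Z ^ 2 * (4 * δ * ω + 4 * δ ^ 2)) =
      Z / ω * (ω ^ 2 / 4 + C ^ 2 * (4 * δ * ω + 4 * δ ^ 2)) := by
    rw [hldef]; field_simp; ring
  have h4 : Z * ω - 2 * (δ * Z) ≤ Z / ω * (ω ^ 2 / 4 + C ^ 2 * (4 * δ * ω + 4 * δ ^ 2)) :=
    h3 ▸ h1.trans h2
  have h5 : (ω - 2 * δ) * ω ≤ ω ^ 2 / 4 + C ^ 2 * (4 * δ * ω + 4 * δ ^ 2) := by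
    have : Z / ω * ((ω - 2 * δ) * ω) ≤ Z / ω * (ω ^ 2 / 4 + C ^ 2 * (4 * δ * ω + 4 * δ ^ 2)) := by
      refine le_trans (le_of_eq ?_) h4
      field_simp
    exact le_of_mul_le_mul_left this (by positivity)
  -- From `ω = 16 (1 + C²) δ` one has `C² δ = ω / 16 - δ`. Then `h5` reduces to `ω² / 2 ≤ -(7/4) δ ω
  -- - 4 δ²`, which is absurd.
  have h6 : C ^ 2 * (4 * δ * ω + 4 * δ ^ 2) = (ω / 16 - δ) * (4 * ω + 4 * δ) := by
    rw [hνδ]; ring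
  rw [h6] at h5
  nlinarith [mul_pos hω hδ, mul_pos hω hω, mul_pos hδ hδ]

/-- For a bounded homomorphism of a C⋆-algebra into `branchAlgebra t`, the images of the
self-adjoint elements vanish at infinity along all but countably many branches. -/
lemma countable_branches {D : Type*} [NonUnitalCStarAlgebra D] (A : D →ₙₐ[ℂ] NodeProd R)
    {C : ℝ} (hC : 0 < C) (hA : ∀ d, ‖A d‖ ≤ C * ‖d‖) {t : ℂ} (ht : t ≠ 0)
    (hmem : ∀ d, A d ∈ K.branchAlgebra t) :
    {x : ℕ → Bool | ∃ d, IsSelfAdjoint d ∧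
      ¬Tendsto (fun n => ev (node x n) (A d)) atTop (𝓝 0)}.Countable := by
  set U := {x : ℕ → Bool | ∃ d, IsSelfAdjoint d ∧
    ¬Tendsto (fun n => ev (node x n) (A d)) atTop (𝓝 0)}
  have hω : 0 < ‖t‖ * ‖K.nil‖ := mul_pos (norm_pos_iff.2 ht) (norm_pos_iff.2 K.nil_ne_zero)
  set δ := ‖t‖ * ‖K.nil‖ / (16 * (1 + C ^ 2)) with hδdef
  have hδ : 0 < δ := by positivity
  have hex : ∀ x : U, ∃ d, IsSelfAdjoint d ∧ ∃ k N : ℕ, TopologicalSpace.denseSeq ℂ k ≠ 0 ∧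
      ∀ n ≥ N, ‖ev (node x n) (A d) - TopologicalSpace.denseSeq ℂ k • K.symbol t (x.1 n)‖ ≤
        δ * ‖TopologicalSpace.denseSeq ℂ k‖ := fun ⟨x, d, hd, h⟩ =>
    ⟨d, hd, K.exists_approx (hmem d) h hδ⟩
  choose d hd k N hk hN using hex
  -- A countable label: index of the approximate coefficient, threshold, and node at the threshold.
  -- Branches with equal labels can separate only at or beyond the threshold, where both
  -- approximations hold.
  let f : U → ℕ × ℕ × List Bool := fun x => (k x, N x, node x (N x))
  suffices hf : Function.Injective f from Set.countable_coe_iff.1 hf.countable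
  intro x y hxy
  by_contra hne
  obtain ⟨hk', hN', hnode⟩ : k x = k y ∧ N x = N y ∧ node x (N x) = node y (N y) := by
    simpa [f] using hxy
  rw [← hN'] at hnode
  obtain ⟨n, hn, hnn, hxyn⟩ := exists_split (fun h => hne (Subtype.ext h)) hnode
  have h1 := hN x n hn
  have h2 := hN y n (hN' ▸ hn)
  rw [← hk', ← hnn] at h2
  obtain ⟨hν1, hν2⟩ := K.symbol_sub_symbol t hxyn
  refine absurd ?_ (not_le.2 (not_near_nilpotent A hC hA ((hd x).sub (hd y)) (node x n) hν2 hδ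
    (norm_pos_iff.2 (hk x)) (by rw [hν1, hδdef]; field_simp) rfl))
  calc _ = ‖(ev (node x n) (A (d x)) - TopologicalSpace.denseSeq ℂ (k x) • K.symbol t (x.1 n)) -
        (ev (node x n) (A (d y)) - TopologicalSpace.denseSeq ℂ (k x) • K.symbol t (y.1 n))‖ := by
        rw [map_sub, map_sub, smul_sub]; congr 1; abel
    _ ≤ _ := (norm_sub_le _ _).trans (add_le_add h1 h2)
    _ = _ := by ring

variable {E : Type} [NonUnitalNormedRing E] [NormedSpace ℂ E] [IsScalarTower ℂ E E]
  [SMulCommClass ℂ E E]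

/-- The inverse isomorphism is a bounded homomorphism into the product. By real and imaginary parts,
every image vanishes at infinity off one countable set of branches, so `B` would lie in a separable
set. -/
theorem not_isIsomorphicToCStarAlgebra [TopologicalSpace.SeparableSpace R]
    (π : NodeProd R →ₙₐ[ℂ] E) (hπ : Isometry π) {t : ℂ} (ht : t ≠ 0) (B : NonUnitalSubalgebra ℂ E)
    (hB : B ≤ (K.branchAlgebra t).map π) (hsep : ¬TopologicalSpace.SeparableSpace B) :
    ¬IsIsomorphicToCStarAlgebra B := by
  rintro ⟨D, _, Φ, hΦ⟩
  have hex : ∀ d : D, ∃ a ∈ K.branchAlgebra t, π a = (Φ.symm d : E) := fun d =>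
    NonUnitalSubalgebra.mem_map.1 (hB (Φ.symm d).2)
  choose f hf hπf using hex
  have hmul : ∀ d e : D, Φ.symm (d * e) = Φ.symm d * Φ.symm e := fun d e => by
    rw [Φ.symm_apply_eq, hΦ, Φ.apply_symm_apply, Φ.apply_symm_apply]
  let A : D →ₙₐ[ℂ] NodeProd R :=
    { toFun := f
      map_smul' := fun z d => hπ.injective (by simp [hπf])
      map_zero' := hπ.injective (by simp [hπf])
      map_add' := fun d e => hπ.injective (by simp [hπf])
      map_mul' := fun d e => hπ.injective (by simp [hπf, hmul]) }
  -- The added `1` keeps the constant positive even when `D` is zero.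
  have hnorm : ∀ d, ‖A d‖ ≤ (‖(Φ.symm : D →L[ℂ] B)‖ + 1) * ‖d‖ := fun d => by
    have h1 : ‖A d‖ = ‖Φ.symm d‖ := by
      rw [← hπ.norm_map_of_map_zero (map_zero π)]
      exact congrArg norm (hπf d)
    rw [h1]
    refine ((Φ.symm : D →L[ℂ] B).le_opNorm d).trans ?_
    gcongr
    linarith
  have hcount := K.countable_branches A (by positivity) hnorm ht hf
  have hS := (K.isSeparable_of_tendsto t hcount).image hπ.continuous
  refine hsep (hS.mono ?_).separableSpace
  intro b hb
  refine ⟨A (Φ ⟨b, hb⟩), ⟨hf _, fun x hx => ?_⟩, by simp [A, hπf]⟩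
  have hsa : ∀ d : D, IsSelfAdjoint d → Tendsto (fun n => ev (node x n) (A d)) atTop (𝓝 0) :=
    fun d hd => by
      by_contra hcon
      exact hx ⟨d, hd, hcon⟩
  have h1 := hsa _ (realPart (Φ ⟨b, hb⟩)).2
  have h2 := hsa _ (imaginaryPart (Φ ⟨b, hb⟩)).2
  have h3 := h1.add (h2.const_smul Complex.I)
  simp only [smul_zero, add_zero, ← map_smul, ← map_add] at h3
  rwa [realPart_add_I_smul_imaginaryPart] at h3

end

end CornerData

/-! ### Perturbing the parameter. -/

namespace CornerData

noncomputable section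

variable {R : Type} [CStarAlgebra R] (K : CornerData R)

lemma norm_comb_sub_comb_apply_le (t u : ℂ) {c : (ℕ → Bool) →₀ ℂ} {s : List Bool}
    (hs : DisjointAt c.support s) {C : ℝ} (hC : 0 ≤ C) (h : ∀ x, ‖c x‖ ≤ C) :
    ‖ev s (K.comb u c - K.comb t c)‖ ≤ C * ‖u - t‖ := by
  rw [map_sub]
  by_cases hx : ∃ x ∈ c.support, OnBranch x s
  · obtain ⟨x, hx, hxs⟩ := hx
    rw [K.comb_apply_of_onBranch subset_rfl hs hx hxs,
      K.comb_apply_of_onBranch subset_rfl hs hx hxs, ← smul_sub, norm_smul]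
    exact mul_le_mul (h x) (K.norm_symbol_sub_le _ _ _) (norm_nonneg _) hC
  · push Not at hx
    rw [K.comb_apply_of_not subset_rfl hx, K.comb_apply_of_not subset_rfl hx, sub_zero, norm_zero]
    positivity

/-- Replacing `t` by `u` in a core approximant, off the crossings only, gives an element within `3
η`. Its norm is then within `3 η < 1` of `1`, and normalizing it costs another `3 η`. -/
lemma exists_near {t u : ℂ} {η : ℝ} (hη : 0 < η) (hη' : η ≤ 1 / 8) (htu : ‖u - t‖ ≤ η)
    {a : NodeProd R} (ha : a ∈ K.branchAlgebra t) (hnorm : ‖a‖ = 1) :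
    ∃ b ∈ K.branchAlgebra u, ‖b‖ = 1 ∧ ‖a - b‖ ≤ 6 * η := by
  obtain ⟨b, ⟨c, hc⟩, hb⟩ := K.exists_mem_coreAlgebra ha hη
  have hb1 : ‖b‖ ≤ 2 := by
    have h1 : ‖b‖ ≤ ‖a‖ + ‖a - b‖ := by
      simpa using norm_sub_le a (a - b)
    linarith
  have hcx : ∀ x, ‖c x‖ ≤ 2 := fun x =>
    K.norm_coeff_le hc x (Eventually.of_forall fun n => (norm_ev_le b _).trans hb1)
  obtain ⟨G, hG⟩ := exists_disjointAt c.support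
  set e := off G (K.comb u c - K.comb t c) with he
  have hen : ‖e‖ ≤ 2 * η := norm_off_le (by positivity) fun s hs =>
    (K.norm_comb_sub_comb_apply_le t u (hG s hs) zero_le_two hcx).trans (by gcongr)
  have hmem : b + e ∈ K.branchAlgebra u := by
    refine K.coreAlgebra_le u ⟨c, ?_⟩
    filter_upwards [hc, eventually_ev_off G (K.comb u c - K.comb t c)] with s h1 h2
    rw [map_add, h1, h2, map_sub, add_sub_cancel]
  have h3 : ‖a - (b + e)‖ ≤ 3 * η := by
    rw [← sub_sub]
    linarith [norm_sub_le (a - b) e]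
  have h4 : |‖b + e‖ - 1| ≤ 3 * η := by
    rw [abs_sub_comm, ← hnorm]
    exact (abs_norm_sub_norm_le _ _).trans h3
  have h5 : 0 < ‖b + e‖ := by linarith [(abs_le.1 h4).1]
  generalize b + e = w at hmem h3 h4 h5
  set κ : ℝ := ‖w‖⁻¹ with hκ
  have hκw : κ * ‖w‖ = 1 := inv_mul_cancel₀ h5.ne'
  refine ⟨(κ : ℂ) • w, SMulMemClass.smul_mem _ hmem, ?_, ?_⟩
  · rw [norm_smul, Complex.norm_real, Real.norm_of_nonneg (by positivity), hκw]
  · have h6 : ‖w - (κ : ℂ) • w‖ ≤ 3 * η := by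
      have h7 : w - (κ : ℂ) • w = ((1 - κ : ℝ) : ℂ) • w := by
        rw [Complex.ofReal_sub, sub_smul, Complex.ofReal_one, one_smul]
      rw [h7, norm_smul, Complex.norm_real, Real.norm_eq_abs]
      calc |1 - κ| * ‖w‖ = |(1 - κ) * ‖w‖| := by rw [abs_mul, abs_norm]
        _ = |‖w‖ - 1| := by rw [sub_mul, one_mul, hκw]
        _ ≤ _ := h4
    calc _ = ‖(a - w) + (w - (κ : ℂ) • w)‖ := by rw [sub_add_sub_cancel]
      _ ≤ 6 * η := by linarith [norm_add_le (a - w) (w - (κ : ℂ) • w)]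

lemma iSup_iInf_le {H : Type} [NormedAddCommGroup H] [InnerProductSpace ℂ H]
    (π : NodeProd R →ₙₐ[ℂ] (H →L[ℂ] H)) (hπ : Isometry π) {t u : ℂ} {η : ℝ} (hη : 0 < η)
    (hη' : η ≤ 1 / 8) (htu : ‖u - t‖ ≤ η) :
    ⨆ x ∈ unitSphereOf ((K.branchAlgebra t).map π),
      ⨅ y ∈ unitSphereOf ((K.branchAlgebra u).map π), ‖x - y‖ₑ ≤ ENNReal.ofReal (6 * η) := by
  refine iSup₂_le fun x hx => ?_
  obtain ⟨⟨a, ha, rfl⟩, hnorm⟩ := hx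
  have hn : ∀ c, ‖π c‖ = ‖c‖ := hπ.norm_map_of_map_zero (map_zero π)
  replace hnorm : ‖a‖ = 1 := by rw [← hn]; exact hnorm
  obtain ⟨b, hb, hb1, hab⟩ := K.exists_near hη hη' htu ha hnorm
  refine (iInf₂_le (π b) ⟨⟨b, hb, rfl⟩, by rw [hn, hb1]⟩).trans ?_
  rw [← ofReal_norm]
  refine ENNReal.ofReal_le_ofReal ?_
  have : π a - π b = π (a - b) := (map_sub π a b).symm
  exact (congrArg norm this).trans_le ((hn _).trans_le hab)

lemma kadisonKastlerDist_le {H : Type} [NormedAddCommGroup H] [InnerProductSpace ℂ H]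
    (π : NodeProd R →ₙₐ[ℂ] (H →L[ℂ] H)) (hπ : Isometry π) {t u : ℂ} {η : ℝ} (hη : 0 < η)
    (hη' : η ≤ 1 / 8) (htu : ‖u - t‖ ≤ η) :
    kadisonKastlerDist ((K.branchAlgebra t).map π) ((K.branchAlgebra u).map π) ≤
      ENNReal.ofReal (6 * η) :=
  max_le (K.iSup_iInf_le π hπ hη hη' htu)
    (K.iSup_iInf_le π hπ hη hη' (by rwa [norm_sub_rev]))

end

end CornerData

/-! ### Bounded finite groups spanning the generators. -/

namespace CornerData

noncomputable section

variable {R : Type} [CStarAlgebra R] (K : CornerData R)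

section Group

variable {V : Type} [Group V] (ψ : V →* R)
  (G : Finset (List Bool)) (F : Finset (ℕ → Bool))

open Classical in
/-- A family of signs as a finitely supported function. -/
def signs (τ : F → ℤˣ) : (ℕ → Bool) →₀ ℂ :=
  Finsupp.onFinset F (fun x => if h : x ∈ F then ((τ ⟨x, h⟩ : ℤ) : ℂ) else 0) fun x hx => by
    by_contra h
    exact hx (dif_neg h)

lemma signs_apply_of_mem (τ : F → ℤˣ) {x : ℕ → Bool} (hx : x ∈ F) :
    signs F τ x = ((τ ⟨x, hx⟩ : ℤ) : ℂ) := by simp [signs, hx]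

lemma signs_apply_of_notMem (τ : F → ℤˣ) {x : ℕ → Bool} (hx : x ∉ F) : signs F τ x = 0 := by
  simp [signs, hx]

lemma support_signs_subset (τ : F → ℤˣ) : (signs F τ).support ⊆ F :=
  Finsupp.support_onFinset_subset

lemma signs_mul (τ τ' : F → ℤˣ) : signs F (τ * τ') = signs F τ * signs F τ' := by
  ext x
  rw [Finsupp.mul_apply]
  by_cases hx : x ∈ F
  · simp [signs_apply_of_mem F _ hx]
  · simp [signs_apply_of_notMem F _ hx]

lemma norm_signs_le (τ : F → ℤˣ) (x : ℕ → Bool) : ‖signs F τ x‖ ≤ 1 := by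
  by_cases hx : x ∈ F
  · rw [signs_apply_of_mem F τ hx]
    rcases Int.units_eq_one_or (τ ⟨x, hx⟩) with h | h <;> simp [h]
  · simp [signs_apply_of_notMem F _ hx]

lemma signs_sub_update [DecidableEq F] {x : ℕ → Bool} (hx : x ∈ F) :
    signs F 1 - signs F (Function.update 1 ⟨x, hx⟩ (-1)) = Finsupp.single x 2 := by
  classical
  ext y
  rw [Finsupp.sub_apply]
  by_cases hy : y ∈ F
  · rw [signs_apply_of_mem F _ hy, signs_apply_of_mem F _ hy]
    by_cases hyx : y = x
    · subst hyx
      simp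
      norm_num
    · rw [Function.update_of_ne (by simpa using hyx), Finsupp.single_eq_of_ne hyx]
      simp
  · have hyx : y ≠ x := fun h => hy (h ▸ hx)
    rw [signs_apply_of_notMem F _ hy, signs_apply_of_notMem F _ hy,
      Finsupp.single_eq_of_ne hyx, sub_zero]

open Classical in
/-- The coordinates of `groupElement`. -/
def groupEntry (t : ℂ) (σ : G → V) (τ : F → ℤˣ) (s : List Bool) : R :=
  if h : s ∈ G then ψ (σ ⟨s, h⟩) else ev s (K.comb t (signs F τ))

variable {ψ G F}

lemma norm_groupEntry_le (hψ : ∀ v, ‖ψ v‖ ≤ 1) (hG : ∀ s ∉ G, DisjointAt F s) (t : ℂ)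
    (σ : G → V) (τ : F → ℤˣ) (s : List Bool) : ‖K.groupEntry ψ G F t σ τ s‖ ≤ 1 + ‖t‖ := by
  rw [groupEntry]
  split_ifs with h
  · exact (hψ _).trans (by linarith [norm_nonneg t])
  · simpa using K.norm_comb_apply_le (t := t) (support_signs_subset F τ) (hG s h) zero_le_one
      (norm_signs_le F τ)

variable (hψ : ∀ v, ‖ψ v‖ ≤ 1) (hG : ∀ s ∉ G, DisjointAt F s)

/-- The finite group of elements with values in `ψ` on `G`, and a signed sum of branch idempotents
off `G`. -/
def groupElement (t : ℂ) (u : (G → V) × (F → ℤˣ)) : NodeProd R :=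
  ofBounded (K.groupEntry ψ G F t u.1 u.2) (1 + ‖t‖) (K.norm_groupEntry_le hψ hG t u.1 u.2)

lemma ev_groupElement_of_mem (t : ℂ) (u : (G → V) × (F → ℤˣ)) {s : List Bool} (h : s ∈ G) :
    ev s (K.groupElement hψ hG t u) = ψ (u.1 ⟨s, h⟩) := by
  simp [groupElement, groupEntry, h]

lemma ev_groupElement_of_notMem (t : ℂ) (u : (G → V) × (F → ℤˣ)) {s : List Bool} (h : s ∉ G) :
    ev s (K.groupElement hψ hG t u) = ev s (K.comb t (signs F u.2)) := by
  simp [groupElement, groupEntry, h]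

lemma groupElement_mul (t : ℂ) (u v : (G → V) × (F → ℤˣ)) :
    K.groupElement hψ hG t (u * v) = K.groupElement hψ hG t u * K.groupElement hψ hG t v := by
  refine ext_ev fun s => ?_
  rw [map_mul]
  by_cases h : s ∈ G
  · simp [K.ev_groupElement_of_mem hψ hG t _ h]
  · rw [K.ev_groupElement_of_notMem hψ hG t _ h, K.ev_groupElement_of_notMem hψ hG t _ h,
      K.ev_groupElement_of_notMem hψ hG t _ h, Prod.snd_mul, signs_mul,
      K.comb_mul_apply (support_signs_subset F _) (support_signs_subset F _) (hG s h)]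

lemma norm_groupElement_le (t : ℂ) (u : (G → V) × (F → ℤˣ)) :
    ‖K.groupElement hψ hG t u‖ ≤ 1 + ‖t‖ :=
  norm_le_of_ev (by positivity) fun s => K.norm_groupEntry_le hψ hG t u.1 u.2 s

lemma groupElement_mem (t : ℂ) (u : (G → V) × (F → ℤˣ)) :
    K.groupElement hψ hG t u ∈ K.coreAlgebra t := by
  refine ⟨signs F u.2, ?_⟩
  filter_upwards [G.eventually_cofinite_notMem] with s hs
    using K.ev_groupElement_of_notMem hψ hG t u hs

/-- Two group elements that differ by the factor `ψ ν = -1` at the node `s` alone have a difference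
supported at `s`. -/
lemma single_mem_span (hspan : Submodule.span ℂ (Set.range ψ) = ⊤) {ν : V} (hν : ψ ν = -1)
    (t : ℂ) {s : List Bool} (hs : s ∈ G) (m : R) :
    single (R := R) s m ∈ Submodule.span ℂ (Set.range (K.groupElement hψ hG t)) := by
  classical
  suffices h : Submodule.span ℂ (Set.range ψ) ≤
      (Submodule.span ℂ (Set.range (K.groupElement hψ hG t))).comap (single (R := R) s) from
    h (hspan ▸ Submodule.mem_top : m ∈ Submodule.span ℂ (Set.range ψ))
  refine Submodule.span_le.2 ?_
  rintro _ ⟨v, rfl⟩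
  have hdiff : K.groupElement hψ hG t (Function.update 1 ⟨s, hs⟩ v, 1) -
      K.groupElement hψ hG t (Function.update 1 ⟨s, hs⟩ (ν * v), 1) =
      (2 : ℂ) • single (R := R) s (ψ v) := by
    refine ext_ev fun s' => ?_
    rw [map_sub, map_smul]
    by_cases h : s' ∈ G
    · rw [K.ev_groupElement_of_mem hψ hG t _ h, K.ev_groupElement_of_mem hψ hG t _ h]
      by_cases hss : s' = s
      · subst hss
        simp [ev_single_self, hν, two_smul]
      · simp [ev_single_of_ne hss, hss]
    · rw [K.ev_groupElement_of_notMem hψ hG t _ h, K.ev_groupElement_of_notMem hψ hG t _ h,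
        ev_single_of_ne (fun h' : s' = s => h (h' ▸ hs)), sub_self, smul_zero]
  have hmem := Submodule.smul_mem (Submodule.span ℂ (Set.range (K.groupElement hψ hG t)))
    (2 : ℂ)⁻¹ (sub_mem (Submodule.subset_span ⟨(Function.update 1 ⟨s, hs⟩ v, 1), rfl⟩)
      (Submodule.subset_span ⟨(Function.update 1 ⟨s, hs⟩ (ν * v), 1), rfl⟩))
  rw [hdiff, smul_smul, inv_mul_cancel₀ two_ne_zero, one_smul] at hmem
  exact hmem

/-- Flipping the sign of `x` isolates twice the part of `gen t x` off `G`; the entries on `G` come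
from `single_mem_span`. -/
lemma gen_mem_span (hspan : Submodule.span ℂ (Set.range ψ) = ⊤) {ν : V} (hν : ψ ν = -1)
    (t : ℂ) {x : ℕ → Bool} (hx : x ∈ F) :
    K.gen t x ∈ Submodule.span ℂ (Set.range (K.groupElement hψ hG t)) := by
  classical
  have hdiff : K.groupElement hψ hG t (1, 1) -
      K.groupElement hψ hG t (1, Function.update 1 ⟨x, hx⟩ (-1)) =
      (2 : ℂ) • off G (K.gen t x) := by
    refine ext_ev fun s => ?_
    rw [map_sub, map_smul]
    by_cases h : s ∈ G
    · rw [K.ev_groupElement_of_mem hψ hG t _ h, K.ev_groupElement_of_mem hψ hG t _ h,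
        ev_off_of_mem h, sub_self, smul_zero]
    · rw [K.ev_groupElement_of_notMem hψ hG t _ h, K.ev_groupElement_of_notMem hψ hG t _ h,
        ev_off_of_notMem h, ← map_sub, ← map_sub, signs_sub_update, comb_single, map_smul]
  have hmem := Submodule.smul_mem (Submodule.span ℂ (Set.range (K.groupElement hψ hG t)))
    (2 : ℂ)⁻¹ (sub_mem (Submodule.subset_span ⟨(1, 1), rfl⟩)
      (Submodule.subset_span ⟨(1, Function.update 1 ⟨x, hx⟩ (-1)), rfl⟩))
  rw [hdiff, smul_smul, inv_mul_cancel₀ two_ne_zero, one_smul] at hmem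
  rw [eq_off_add_sum G (K.gen t x)]
  exact add_mem hmem (sum_mem fun s hs => K.single_mem_span hψ hG hspan hν t hs _)

end Group

theorem isAmenableBanachAlgebra_map {E : Type} [NonUnitalNormedRing E] [NormedSpace ℂ E]
    [IsScalarTower ℂ E E] [SMulCommClass ℂ E E] (π : NodeProd R →ₙₐ[ℂ] E) (hπ : Isometry π)
    {V : Type} [Group V] [Finite V] (ψ : V →* R) (hψ : ∀ v, ‖ψ v‖ ≤ 1)
    (hspan : Submodule.span ℂ (Set.range ψ) = ⊤) {ν : V} (hν : ψ ν = -1) (t : ℂ) :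
    IsAmenableBanachAlgebra ((K.branchAlgebra t).map π) := by
  classical
  have := Fintype.ofFinite V
  let T : Finset (List Bool) × Finset (ℕ → Bool) → Set (NodeProd R) := fun i =>
    (⋃ s ∈ i.1, Set.range (single (R := R) s)) ∪ K.gen t '' i.2
  have hT : ∀ i, T i ⊆ K.generators t Set.univ := fun i =>
    Set.union_subset_union (Set.iUnion₂_subset_iUnion _ _) (Set.image_mono (Set.subset_univ _))
  have hTU : K.generators t Set.univ ⊆ ⋃ i, T i := by
    rintro a (ha | ⟨x, -, rfl⟩)
    · obtain ⟨s, hs⟩ := Set.mem_iUnion.1 ha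
      exact Set.mem_iUnion.2 ⟨({s}, ∅), Or.inl (by simpa using hs)⟩
    · exact Set.mem_iUnion.2 ⟨(∅, {x}), Or.inr (by simp)⟩
  let L : NodeProd R →ₗ[ℂ] E := (π : NodeProd R →ₗ[ℂ] E)
  have hn : ∀ c, ‖π c‖ = ‖c‖ := hπ.norm_map_of_map_zero (map_zero π)
  refine isAmenableBanachAlgebra_of_directed _ (fun i => π '' T i) (fun i j hij => ?_)
    (fun i => ?_) (fun a ha => ?_) (1 + ‖t‖) (fun i => ?_)
  · refine Set.image_mono (Set.union_subset_union ?_ (Set.image_mono hij.2))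
    exact Set.biUnion_subset_biUnion_left hij.1
  · rintro _ ⟨a, ha, rfl⟩
    exact ⟨a, K.coreAlgebra_le t (K.generators_subset t _ (hT i ha)), rfl⟩
  · obtain ⟨b, hb, rfl⟩ := ha
    have h1 := image_closure_subset_closure_image hπ.continuous
      (Set.mem_image_of_mem π (K.branchAlgebra_subset_closure_span t hb))
    refine closure_mono ?_ h1
    have h2 : (Submodule.span ℂ (K.generators t Set.univ)).map L ≤
        Submodule.span ℂ (⋃ i, π '' T i) := by
      rw [Submodule.map_span, ← Set.image_iUnion]
      exact Submodule.span_mono (Set.image_mono hTU)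
    exact h2
  · obtain ⟨G, hG⟩ := exists_disjointAt i.2
    -- Adjoining the crossings to the node set makes the branches disjoint outside it, which gives
    -- multiplicativity and the norm bound.
    have hG' : ∀ s ∉ i.1 ∪ G, DisjointAt i.2 s := fun s hs =>
      hG s fun h => hs (Finset.mem_union_right _ h)
    refine ⟨(↥(i.1 ∪ G) → V) × (i.2 → ℤˣ), inferInstance, inferInstance,
      fun u => π (K.groupElement hψ hG' t u), fun u v => ?_, fun u => ?_, fun u => ?_, ?_⟩
    · simp only [groupElement_mul, map_mul]
    · exact ⟨_, K.coreAlgebra_le t (K.groupElement_mem hψ hG' t u), rfl⟩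
    · rw [hn]
      exact K.norm_groupElement_le hψ hG' t u
    · have h2 : (Submodule.span ℂ (Set.range (K.groupElement hψ hG' t))).map L =
          Submodule.span ℂ (Set.range fun u => π (K.groupElement hψ hG' t u)) := by
        rw [Submodule.map_span, ← Set.range_comp]
        rfl
      rw [← h2]
      refine Set.image_mono ?_
      rintro a (ha | ⟨x, hx, rfl⟩)
      · obtain ⟨s, hs, m, rfl⟩ := Set.mem_iUnion₂.1 ha
        exact K.single_mem_span hψ hG' hspan hν t (Finset.mem_union_left _ hs) m
      · exact K.gen_mem_span hψ hG' hspan hν t hx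

end

end CornerData

/-! ### The diagonal representation on a separable Hilbert space. -/

namespace CornerData

noncomputable section

section Representation

variable {E : Type} [NormedAddCommGroup E] [InnerProductSpace ℂ E] [CompleteSpace E]

/-- The Hilbert sum of copies of `E` indexed by the nodes of the binary tree. -/
abbrev NodeSum (E : Type) [NormedAddCommGroup E] : Type := lp (fun _ : List Bool => E) 2

/-- The vector with coordinates `a s (v s)`. -/
def diagonalVec (a : NodeProd (E →L[ℂ] E)) (v : NodeSum E) : NodeSum E :=
  ⟨fun s => ev s a (v s), (lp.memℓp ((‖a‖ : ℂ) • v)).mono' fun s => by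
    refine ((ev s a).le_opNorm (v s)).trans ?_
    rw [lp.coeFn_smul, Pi.smul_apply, norm_smul, Complex.norm_real, norm_norm]
    gcongr
    exact norm_ev_le a s⟩

lemma norm_diagonalVec_le (a : NodeProd (E →L[ℂ] E)) (v : NodeSum E) :
    ‖diagonalVec a v‖ ≤ ‖a‖ * ‖v‖ := by
  have h : ‖diagonalVec a v‖ ≤ ‖(‖a‖ : ℂ) • v‖ := by
    refine lp.norm_mono two_ne_zero fun s => ?_
    refine ((ev s a).le_opNorm (v s)).trans ?_
    rw [lp.coeFn_smul, Pi.smul_apply, norm_smul, Complex.norm_real, norm_norm]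
    gcongr
    exact norm_ev_le a s
  rwa [norm_smul, Complex.norm_real, norm_norm] at h

/-- The diagonal operator of a bounded family of operators. -/
def diagonalOp (a : NodeProd (E →L[ℂ] E)) : NodeSum E →L[ℂ] NodeSum E :=
  LinearMap.mkContinuous
    { toFun := diagonalVec a
      map_add' := fun v w => lp.ext (funext fun s => (ev s a).map_add (v s) (w s))
      map_smul' := fun z v => lp.ext (funext fun s => (ev s a).map_smul z (v s)) }
    ‖a‖ (norm_diagonalVec_le a)

lemma diagonalOp_apply (a : NodeProd (E →L[ℂ] E)) (v : NodeSum E) (s : List Bool) :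
    diagonalOp a v s = ev s a (v s) := rfl

/-- The diagonal representation of `NodeProd (B(E))`. -/
def diagonalRep : NodeProd (E →L[ℂ] E) →⋆ₙₐ[ℂ] (NodeSum E →L[ℂ] NodeSum E) where
  toFun := diagonalOp
  map_smul' _ _ := rfl
  map_zero' := rfl
  map_add' _ _ := rfl
  map_mul' _ _ := rfl
  map_star' a := by
    rw [ContinuousLinearMap.star_eq_adjoint, ContinuousLinearMap.eq_adjoint_iff]
    intro v w
    rw [lp.inner_eq_tsum, lp.inner_eq_tsum]
    refine tsum_congr fun s => ?_
    rw [diagonalOp_apply, diagonalOp_apply, map_star, ContinuousLinearMap.star_eq_adjoint,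
      ContinuousLinearMap.adjoint_inner_left]

lemma diagonalRep_injective :
    Function.Injective (diagonalRep : NodeProd (E →L[ℂ] E) →⋆ₙₐ[ℂ] _) := fun a b h => by
  refine ext_ev fun s => ContinuousLinearMap.ext fun v => ?_
  have h1 := congrArg (fun T : NodeSum E →L[ℂ] NodeSum E =>
    T (lp.single (E := fun _ : List Bool => E) 2 s v) s) h
  have h2 : lp.single (E := fun _ : List Bool => E) 2 s v s = v := 
    lp.single_apply_self (E := fun _ : List Bool => E) 2 s v
  change ev s a (lp.single (E := fun _ : List Bool => E) 2 s v s) =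
    ev s b (lp.single (E := fun _ : List Bool => E) 2 s v s) at h1
  rwa [h2] at h1

lemma isometry_diagonalRep : Isometry (diagonalRep : NodeProd (E →L[ℂ] E) →⋆ₙₐ[ℂ] _) :=
  AddMonoidHomClass.isometry_of_norm _ fun a =>
    NonUnitalStarAlgHom.norm_map diagonalRep diagonalRep_injective a

omit [CompleteSpace E] in
lemma separableSpace_nodeSum [TopologicalSpace.SeparableSpace E] :
    TopologicalSpace.SeparableSpace (NodeSum E) := by
  have h1 : TopologicalSpace.IsSeparable
      (⋃ s, Set.range (lp.single (E := fun _ : List Bool => E) 2 s)) :=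
    TopologicalSpace.IsSeparable.iUnion fun s => TopologicalSpace.isSeparable_range
      (lp.isometry_single (E := fun _ : List Bool => E) (p := 2) s).continuous
  have h2 := (h1.span (R := ℂ)).closure
  refine TopologicalSpace.isSeparable_univ_iff.1 (h2.mono fun v _ => ?_)
  refine mem_closure_of_tendsto (lp.hasSum_single (by simp) v) (Eventually.of_forall fun F => ?_)
  exact sum_mem fun s _ => Submodule.subset_span (Set.mem_iUnion.2 ⟨s, _, rfl⟩)

end Representation

lemma star_mem_branchAlgebra_zero {R : Type} [CStarAlgebra R] (K : CornerData R)
    {a : NodeProd R} (ha : a ∈ K.branchAlgebra 0) : star a ∈ K.branchAlgebra 0 := by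
  refine Metric.mem_closure_iff.2 fun ε hε => ?_
  obtain ⟨b, ⟨c, hc⟩, hb⟩ := K.exists_mem_coreAlgebra ha hε
  refine ⟨star b, ⟨c.mapRange star (star_zero ℂ), ?_⟩, ?_⟩
  · filter_upwards [hc] with s hs
    have h1 : (c.mapRange star (star_zero ℂ)).support ⊆ c.support := Finsupp.support_mapRange
    rw [map_star, hs, K.comb_apply subset_rfl, K.comb_apply h1, star_sum]
    refine Finset.sum_congr rfl fun x _ => ?_
    rw [star_smul, Finsupp.mapRange_apply]
    congr 1
    by_cases hx : OnBranch x s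
    · rw [K.gen_apply_of_onBranch hx, K.star_symbol_zero]
    · rw [K.gen_apply_of_not hx, star_zero]
  · rwa [dist_eq_norm, ← star_sub, norm_star]

section OperatorAlgebra

variable {E : Type} [NormedAddCommGroup E] [InnerProductSpace ℂ E] [CompleteSpace E]
  (K : CornerData (E →L[ℂ] E))

/-- The operator algebra with parameter `t`. -/
def operatorAlgebra (t : ℂ) : NonUnitalSubalgebra ℂ (NodeSum E →L[ℂ] NodeSum E) :=
  (K.branchAlgebra t).map (diagonalRep (E := E)).toNonUnitalAlgHom

lemma isClosed_operatorAlgebra (t : ℂ) :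
    IsClosed (K.operatorAlgebra t : Set (NodeSum E →L[ℂ] NodeSum E)) :=
  (isometry_diagonalRep (E := E)).isClosedEmbedding.isClosedMap _ (K.isClosed_branchAlgebra t)

/-- The operator algebra with parameter `0` is self-adjoint. -/
def operatorCStarAlgebra : NonUnitalStarSubalgebra ℂ (NodeSum E →L[ℂ] NodeSum E) where
  __ := K.operatorAlgebra 0
  star_mem' := by
    rintro _ ⟨a, ha, rfl⟩
    exact ⟨star a, K.star_mem_branchAlgebra_zero ha, map_star (diagonalRep (E := E)) a⟩

lemma not_separableSpace_operatorAlgebra (t : ℂ) :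
    ¬TopologicalSpace.SeparableSpace (K.operatorAlgebra t) := by
  intro h
  refine K.not_isSeparable_branchAlgebra t ?_
  have h1 : TopologicalSpace.IsSeparable
      (K.operatorAlgebra t : Set (NodeSum E →L[ℂ] NodeSum E)) :=
    TopologicalSpace.IsSeparable.of_subtype _
  have h2 := (isometry_diagonalRep (E := E)).isEmbedding.isInducing.isSeparable_preimage h1
  exact h2.mono fun a ha => ⟨a, ha, rfl⟩

theorem exists_amenable_near_cstarAlgebra (K : CornerData (E →L[ℂ] E))
    [TopologicalSpace.SeparableSpace E]
    [TopologicalSpace.SeparableSpace (E →L[ℂ] E)] {V : Type} [Group V] [Finite V]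
    (ψ : V →* (E →L[ℂ] E)) (hψ : ∀ v, ‖ψ v‖ ≤ 1)
    (hspan : Submodule.span ℂ (Set.range ψ) = ⊤) {ν : V} (hν : ψ ν = -1) :
    ∃ (H : Type) (_ : NormedAddCommGroup H) (_ : InnerProductSpace ℂ H) (_ : CompleteSpace H)
      (_ : TopologicalSpace.SeparableSpace H)
      (C : NonUnitalStarSubalgebra ℂ (H →L[ℂ] H)),
      IsClosed (C : Set (H →L[ℂ] H)) ∧
      ∀ ε : ℝ, 0 < ε →
        ∃ A : NonUnitalSubalgebra ℂ (H →L[ℂ] H),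
          IsClosed (A : Set (H →L[ℂ] H)) ∧
          ¬ TopologicalSpace.SeparableSpace A ∧
          IsAmenableBanachAlgebra A ∧
          (∀ B : NonUnitalSubalgebra ℂ (H →L[ℂ] H), B ≤ A →
            ¬ TopologicalSpace.SeparableSpace B → ¬ IsIsomorphicToCStarAlgebra B) ∧
          kadisonKastlerDist A C.toNonUnitalSubalgebra < ENNReal.ofReal ε := by
  refine ⟨NodeSum E, inferInstance, inferInstance, inferInstance,
    separableSpace_nodeSum, K.operatorCStarAlgebra, K.isClosed_operatorAlgebra 0, fun ε hε => ?_⟩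
  -- The distance is at most `6 η ≤ ε / 2`; the bound `1 / 8` is required by `exists_near`.
  set η : ℝ := min (1 / 8) (ε / 12) with hη
  have hη0 : 0 < η := by positivity
  have hηn : ‖(η : ℂ)‖ = η := by rw [Complex.norm_real, Real.norm_of_nonneg hη0.le]
  have hiso := isometry_diagonalRep (E := E)
  refine ⟨K.operatorAlgebra η, K.isClosed_operatorAlgebra _,
    K.not_separableSpace_operatorAlgebra _,
    K.isAmenableBanachAlgebra_map (diagonalRep (E := E)).toNonUnitalAlgHom hiso ψ hψ hspan hν η,
    fun B hB hsep => K.not_isIsomorphicToCStarAlgebra (diagonalRep (E := E)).toNonUnitalAlgHom hiso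
      (Complex.ofReal_ne_zero.2 hη0.ne') B hB hsep, ?_⟩
  refine (K.kadisonKastlerDist_le (diagonalRep (E := E)).toNonUnitalAlgHom hiso (t := η) (u := 0)
    hη0 (min_le_left _ _) (by rw [zero_sub, norm_neg, hηn])).trans_lt ?_
  rw [ENNReal.ofReal_lt_ofReal_iff hε]
  linarith [min_le_right (1 / 8) (ε / 12)]

end OperatorAlgebra

/-! ### The fiber `B(ℂ²)` and its group of signed permutation matrices. -/

/-- The algebra of operators on `ℂ²`. -/
abbrev Fiber : Type := EuclideanSpace ℂ (Fin 2) →L[ℂ] EuclideanSpace ℂ (Fin 2)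

/-- The operator with a given matrix. -/
def op : Matrix (Fin 2) (Fin 2) ℂ ≃⋆ₐ[ℂ] Fiber := Matrix.toEuclideanCLM (n := Fin 2) (𝕜 := ℂ)

lemma isStarProjection_op {m : Matrix (Fin 2) (Fin 2) ℂ} (h : m * m = m) (h' : star m = m) :
    IsStarProjection (op m) :=
  ⟨by rw [IsIdempotentElem, ← map_mul, h], by rw [IsSelfAdjoint, ← map_star, h']⟩

/-- The matrix units of `B(ℂ²)`. -/
def fiberData : CornerData Fiber where
  proj := op !![1, 0; 0, 0]
  nil := op !![0, 1; 0, 0]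
  corner := (EuclideanSpace.proj 0).comp
    (ContinuousLinearMap.apply ℂ (EuclideanSpace ℂ (Fin 2)) (EuclideanSpace.single 0 1))
  proj_mul_proj := by
    rw [← map_mul]; congr 1; ext i j; fin_cases i <;> fin_cases j <;> simp
  proj_mul_nil := by
    rw [← map_mul]; congr 1; ext i j; fin_cases i <;> fin_cases j <;> simp
  nil_mul_proj := by
    rw [← map_mul, ← map_zero op]; congr 1; ext i j; fin_cases i <;> fin_cases j <;> simp
  nil_mul_nil := by
    rw [← map_mul, ← map_zero op]; congr 1; ext i j; fin_cases i <;> fin_cases j <;> simp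
  star_proj := by
    rw [← map_star]; congr 1; ext i j; fin_cases i <;> fin_cases j <;> simp
  norm_proj_le := by
    refine (isStarProjection_op ?_ ?_).norm_le <;>
      (ext i j; fin_cases i <;> fin_cases j <;> simp)
  norm_nil_le := by
    -- `E₁₂* E₁₂ = E₂₂` is a projection, so the C⋆-identity bounds `‖E₁₂‖`.
    have h : IsStarProjection (op !![0, 0; 0, 1]) := by
      refine isStarProjection_op ?_ ?_ <;> (ext i j; fin_cases i <;> fin_cases j <;> simp)
    have h2 : star (op !![0, 1; 0, 0]) * op !![0, 1; 0, 0] = op !![0, 0; 0, 1] := by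
      rw [← map_star, ← map_mul]; congr 1
      ext i j; fin_cases i <;> fin_cases j <;> simp [Matrix.mul_apply]
    have h3 := CStarRing.norm_star_mul_self (x := op !![0, 1; 0, 0])
    rw [h2] at h3
    nlinarith [h.norm_le, norm_nonneg (op !![0, 1; 0, 0])]
  nil_ne_zero := by
    rw [Ne, map_eq_zero_iff op op.injective]
    intro h
    simpa using congrFun (congrFun h 0) 1
  corner_proj := by
    change (Matrix.toEuclideanCLM (n := Fin 2) (𝕜 := ℂ) !![1, 0; 0, 0]
      (EuclideanSpace.single 0 1)).ofLp 0 = _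
    rw [Matrix.ofLp_toEuclideanCLM]
    simp [Matrix.mulVec, dotProduct]
  corner_nil := by
    change (Matrix.toEuclideanCLM (n := Fin 2) (𝕜 := ℂ) !![0, 1; 0, 0]
      (EuclideanSpace.single 0 1)).ofLp 0 = _
    rw [Matrix.ofLp_toEuclideanCLM]
    simp [Matrix.mulVec, dotProduct]
  norm_corner_le a := by
    refine (PiLp.norm_apply_le _ _).trans ((a.le_opNorm _).trans ?_)
    simp

/-- The representation of the integral orthogonal matrices on `ℂ²`. -/
def orthogonalRep : Matrix.orthogonalGroup (Fin 2) ℤ →* Fiber where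
  toFun u := op ((u : Matrix (Fin 2) (Fin 2) ℤ).map (Int.cast : ℤ → ℂ))
  map_one' := by
    rw [← map_one op]
    congr 1
    exact Matrix.map_one _ Int.cast_zero Int.cast_one
  map_mul' u v := by
    rw [← map_mul]
    congr 1
    exact Matrix.map_mul (f := Int.castRingHom ℂ)

lemma orthogonalRep_apply (u : Matrix.orthogonalGroup (Fin 2) ℤ) :
    orthogonalRep u = op ((u : Matrix (Fin 2) (Fin 2) ℤ).map (Int.cast : ℤ → ℂ)) := rfl

instance finite_orthogonalGroup : Finite (Matrix.orthogonalGroup (Fin 2) ℤ) := by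
  -- The squares in each row sum to `1`, which forces integer entries into `{-1, 0, 1}`.
  let f : Matrix.orthogonalGroup (Fin 2) ℤ → Fin 2 → Fin 2 → Set.Icc (-1 : ℤ) 1 := fun u i j =>
    ⟨u.1 i j, by
      have h := congrFun (congrFun ((Matrix.mem_orthogonalGroup_iff _ _).1 u.2) i) i
      simp only [Matrix.mul_apply, Fin.sum_univ_two, Matrix.transpose_apply,
        Matrix.one_apply_eq] at h
      rw [Set.mem_Icc, ← abs_le, ← sq_le_one_iff_abs_le_one]
      fin_cases j <;> simp only [Fin.zero_eta, Fin.mk_one] <;>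
        nlinarith [sq_nonneg (u.1 i 0), sq_nonneg (u.1 i 1)]⟩
  refine Finite.of_injective f fun u v h => Subtype.ext (Matrix.ext fun i j => ?_)
  exact congrArg Subtype.val (congrFun (congrFun h i) j)

lemma norm_orthogonalRep_le (u : Matrix.orthogonalGroup (Fin 2) ℤ) : ‖orthogonalRep u‖ ≤ 1 := by
  have h : star (orthogonalRep u) * orthogonalRep u = 1 := by
    have h1 : star ((u : Matrix (Fin 2) (Fin 2) ℤ).map (Int.cast : ℤ → ℂ)) =
        (star u : Matrix.orthogonalGroup (Fin 2) ℤ).1.map (Int.cast : ℤ → ℂ) := by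
      ext i j
      simp [Matrix.star_apply]
    rw [orthogonalRep_apply, ← map_star, h1, ← orthogonalRep_apply, ← orthogonalRep_apply,
      ← map_mul, Unitary.star_mul_self, map_one]
  have h3 := CStarRing.norm_star_mul_self (x := orthogonalRep u)
  rw [h, norm_one] at h3
  nlinarith [norm_nonneg (orthogonalRep u)]

lemma mem_orthogonalGroup_of_eq {m : Matrix (Fin 2) (Fin 2) ℤ} (h : m * m.transpose = 1) :
    m ∈ Matrix.orthogonalGroup (Fin 2) ℤ := (Matrix.mem_orthogonalGroup_iff _ _).2 h

lemma span_orthogonalRep : Submodule.span ℂ (Set.range orthogonalRep) = ⊤ := by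
  refine eq_top_iff.2 fun a _ => ?_
  obtain ⟨m, rfl⟩ : ∃ m, op m = a := op.surjective a
  have hmem : ∀ n : Matrix (Fin 2) (Fin 2) ℤ, n * n.transpose = 1 →
      op (n.map (Int.cast : ℤ → ℂ)) ∈ Submodule.span ℂ (Set.range orthogonalRep) := fun n hn =>
    Submodule.subset_span ⟨⟨n, mem_orthogonalGroup_of_eq hn⟩, rfl⟩
  have h1 := hmem !![1, 0; 0, 1] (by decide)
  have h2 := hmem !![1, 0; 0, -1] (by decide)
  have h3 := hmem !![0, 1; 1, 0] (by decide)
  have h4 := hmem !![0, 1; -1, 0] (by decide)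
  -- The identity, `diag(1, -1)`, the swap and the quarter turn form a basis of the matrices.
  have hm : m = ((m 0 0 + m 1 1) / 2) • (!![1, 0; 0, 1] : Matrix (Fin 2) (Fin 2) ℤ).map Int.cast +
      ((m 0 0 - m 1 1) / 2) • (!![1, 0; 0, -1] : Matrix (Fin 2) (Fin 2) ℤ).map Int.cast +
      ((m 0 1 + m 1 0) / 2) • (!![0, 1; 1, 0] : Matrix (Fin 2) (Fin 2) ℤ).map Int.cast +
      ((m 0 1 - m 1 0) / 2) • (!![0, 1; -1, 0] : Matrix (Fin 2) (Fin 2) ℤ).map Int.cast := by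
    ext i j
    fin_cases i <;> fin_cases j <;> simp <;> ring
  rw [hm]
  have hsmul : ∀ (z : ℂ) (n : Matrix (Fin 2) (Fin 2) ℂ), op (z • n) = z • op n := map_smul op
  rw [map_add, map_add, map_add, hsmul, hsmul, hsmul, hsmul]
  exact add_mem (add_mem (add_mem (Submodule.smul_mem _ _ h1) (Submodule.smul_mem _ _ h2))
    (Submodule.smul_mem _ _ h3)) (Submodule.smul_mem _ _ h4)

lemma exists_orthogonalRep_eq_neg_one : ∃ ν, orthogonalRep ν = -1 := by
  refine ⟨⟨-1, mem_orthogonalGroup_of_eq (by simp)⟩, ?_⟩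
  rw [orthogonalRep_apply, ← map_one op, ← map_neg]
  congr 1
  ext i j
  simp [Matrix.one_apply]

instance separableSpace_fiber : TopologicalSpace.SeparableSpace Fiber := by
  have : ProperSpace Fiber := FiniteDimensional.proper_rclike ℂ Fiber
  infer_instance

end

end CornerData

open CornerData in
theorem theorem2 :
    ∃ (H : Type) (_ : NormedAddCommGroup H) (_ : InnerProductSpace ℂ H) (_ : CompleteSpace H)
      (_ : TopologicalSpace.SeparableSpace H)
      (C : NonUnitalStarSubalgebra ℂ (H →L[ℂ] H)),
      IsClosed (C : Set (H →L[ℂ] H)) ∧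
      ∀ ε : ℝ, 0 < ε →
        ∃ A : NonUnitalSubalgebra ℂ (H →L[ℂ] H),
          IsClosed (A : Set (H →L[ℂ] H)) ∧
          ¬ TopologicalSpace.SeparableSpace A ∧
          IsAmenableBanachAlgebra A ∧
          (∀ B : NonUnitalSubalgebra ℂ (H →L[ℂ] H), B ≤ A →
            ¬ TopologicalSpace.SeparableSpace B → ¬ IsIsomorphicToCStarAlgebra B) ∧
          kadisonKastlerDist A C.toNonUnitalSubalgebra < ENNReal.ofReal ε := by
  obtain ⟨ν, hν⟩ := exists_orthogonalRep_eq_neg_one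
  exact fiberData.exists_amenable_near_cstarAlgebra orthogonalRep norm_orthogonalRep_le
    span_orthogonalRep hν
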